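/- For $f\in L^2(\mathbb R)$ (complex valued) put $\widehat f(\xi)=\int_{\mathbb R}e^{-ix\xi}f(x)\,dx$ (extended to $L^2(\mathbb R)$ by Plancherel) and $$e^{it\Delta}f(x)=\frac1{2\pi}\int_{\mathbb R}e^{ix\xi+i\xi^2t}\,\widehat f(\xi)\,d\xi ,\qquad t\in\mathbb R,$$ the integral being understood, for each $t$, as the inverse Fourier transform on $L^2(\mathbb R)$. Let $$\|e^{it\Delta}f\|_{L^6(\mathbb R^2)}=\Big(\int_{\mathbb R}\int_{\mathbb R}|e^{it\Delta}f(x)|^6\,dx\,dt\Big)^{1/6},\qquad C_1=\sup\Big\{\frac{\|e^{it\Delta}f\|_{L^6(\mathbb R^2)}}{\|f\|_{L^2(\mathbb R)}}: f\in L^2(\mathbb R),\ f\neq 0\Big\}.$$ Suppose that $f\in L^2(\mathbb R)$ is an extremizer of the one-dimensional Strichartz inequality $\|e^{it\Delta}f\|_{L^6(\mathbb R^2)}\le C_1\|f\|_{L^2(\mathbb R)}$, that is, $f\neq0$ and $\|e^{it\Delta}f\|_{L^6(\mathbb R^2)}=C_1\|f\|_{L^2(\mathbb R)}$. Then there are $A,B,C\in\mathbb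 C$ with $\operatorname{Re}A<0$ such that $f(x)=e^{Ax^2+Bx+C}$ for almost every $x\in\mathbb R$. -/

import Mathlib

open MeasureTheory
open scoped FourierTransform ENNReal

noncomputable section

/-- The Schrödinger phase `e^{i t ξ²}` at the angular frequency `ξ = 2πη`. Mathlib's Fourier
transform is `𝓕 f η = ∫ e^{-2πixη} f x dx`, so the transform `f̂ ξ = ∫ e^{-ixξ} f x dx` in angular
frequency is `f̂ (2πη) = 𝓕 f η`. -/
def schrodingerPhase (t η : ℝ) : ℂ :=
  Complex.exp (Complex.I * (((2 * Real.pi * η) ^ 2 * t : ℝ) : ℂ))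

theorem norm_schrodingerPhase (t η : ℝ) : ‖schrodingerPhase t η‖ = 1 := by
  rw [schrodingerPhase, mul_comm]
  exact Complex.norm_exp_ofReal_mul_I _

theorem continuous_schrodingerPhase (t : ℝ) : Continuous (schrodingerPhase t) := by
  unfold schrodingerPhase
  fun_prop

theorem memLp_schrodingerPhase_mul (t : ℝ) (g : Lp ℂ 2 (volume : Measure ℝ)) :
    MemLp (fun η : ℝ => schrodingerPhase t η * g η) 2 volume := by
  refine (Lp.memLp g).of_le
    ((continuous_schrodingerPhase t).aestronglyMeasurable.mul (Lp.aestronglyMeasurable g)) ?_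
  exact Filter.Eventually.of_forall fun η => by simp [norm_schrodingerPhase]

/-- The evolution `e^{itΔ} f` of `f ∈ L²(ℝ)`, an element of `L²(ℝ)` for each time `t`:
`e^{itΔ} f (x) = (1/2π) ∫ e^{ixξ + iξ²t} f̂(ξ) dξ = ∫ e^{2πixη} e^{i(2πη)²t} 𝓕 f (η) dη`
(the substitution is `ξ = 2πη`), where the Fourier transform and its inverse are the unitary
(Plancherel) ones on `L²(ℝ)`. -/
def schrodingerEvolution (t : ℝ) (f : Lp ℂ 2 (volume : Measure ℝ)) :
    Lp ℂ 2 (volume : Measure ℝ) :=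
  𝓕⁻ ((memLp_schrodingerPhase_mul t (𝓕 f)).toLp _)

/-- The space-time norm `‖e^{itΔ} f‖_{L⁶(ℝ²)} = (∫∫ |e^{itΔ} f (x)|⁶ dx dt)^{1/6}`, with values in
`[0, ∞]`. It is written as an iterated integral because `e^{itΔ} f` is given, for each `t`, as a
class of functions of `x`. -/
def strichartzNorm (f : Lp ℂ 2 (volume : Measure ℝ)) : ℝ≥0∞ :=
  (∫⁻ t : ℝ, ∫⁻ x : ℝ, ‖schrodingerEvolution t f x‖ₑ ^ 6) ^ (1 / 6 : ℝ)

/-- The sharp constant `C₁ = sup {‖e^{itΔ} f‖_{L⁶(ℝ²)} / ‖f‖₂ : f ∈ L²(ℝ), f ≠ 0}`. -/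
def strichartzConstant : ℝ≥0∞ :=
  ⨆ (f : Lp ℂ 2 (volume : Measure ℝ)) (_ : f ≠ 0), strichartzNorm f / ‖f‖ₑ

/-- `f` is an extremizer of the Strichartz inequality `‖e^{itΔ} f‖_{L⁶(ℝ²)} ≤ C₁ ‖f‖₂`. -/
def IsStrichartzExtremizer (f : Lp ℂ 2 (volume : Measure ℝ)) : Prop :=
  f ≠ 0 ∧ strichartzNorm f = strichartzConstant * ‖f‖ₑ

end

/-! The exponent 6 is twice 3, so the sixth power of the norm is the squared `L²` norm of the cube
of the wave. With `g = 𝓕 f`, that cube is an oscillatory integral of `g ⊗ g ⊗ g` over `ℝ³` whose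
phase sees a point only through its coordinate sum `s` and its distance from the diagonal.
Plancherel in `x` (dual to `s`) and in `t` (dual to the squared distance) turns the norm into the
`L²` norm of the integrals of `g ⊗ g ⊗ g` over circles around the diagonal. Comparing a function on
a circle with its mean then gives an exact identity, `waveNormSix_add_rotDefect`: a multiple of the
sixth power of the norm plus the rotation defect equals a multiple of `‖f‖⁶`.

The identity is proved for continuous `g` with Gaussian decay. Density and lower semicontinuity of
both terms on the left leave an inequality for all of `L²`, `strichartzSix_add_rotDefect_le`. A
centred Gaussian has zero defect, which identifies the sharp constant, so an extremizer has zero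
defect too: `g ⊗ g ⊗ g` is invariant under rotations around the diagonal.

Such a `g` is Gaussian. Multiplying it by `e^{-η²}` keeps the invariance and makes the inverse
Fourier transform `h` differentiable. The Fourier transform commutes with rotations, so `h ⊗ h ⊗ h`
is invariant as well, now pointwise. Differentiating in the angle gives `h' = (αy + β) h`, so `h` is
the exponential of a quadratic. Fourier inversion, division by `e^{-η²}` and square integrability
carry this back to `g` and then to `f`. -/

/-! ### Plancherel on `L¹ ∩ L²` and almost everywhere convergence -/

theorem continuous_fourierInv_of_integrable {G : ℝ → ℂ} (h1 : Integrable G) : Continuous (𝓕⁻ G) :=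
  VectorFourier.fourierIntegral_continuous (L := -innerₗ ℝ) Real.continuous_fourierChar
    continuous_inner.neg h1

/-- On `L¹ ∩ L²` the Plancherel inverse Fourier transform is given by the Fourier integral. -/
theorem fourierInv_toLp_ae_eq {G : ℝ → ℂ} (h1 : Integrable G) (h2 : MemLp G 2 volume) :
    (𝓕⁻ (h2.toLp G) : Lp ℂ 2 (volume : Measure ℝ)) =ᵐ[volume] 𝓕⁻ G := by
  have hc : Continuous (𝓕⁻ G) := continuous_fourierInv_of_integrable h1
  refine ae_eq_of_integral_contDiff_smul_eq
    ((Lp.memLp _).locallyIntegrable (by norm_num)) hc.locallyIntegrable fun φ hφ hφc => ?_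
  -- Both sides are tested against `φ`. The `L²` transform moves onto the Schwartz function `ψ` by
  -- duality of tempered distributions, the Fourier integral by Fubini.
  set ψ : SchwartzMap ℝ ℂ := HasCompactSupport.toSchwartzMap
    (f := fun x => (φ x : ℂ)) (hφc.comp_left (g := fun x : ℝ => (x : ℂ)) rfl)
    (Complex.ofRealCLM.contDiff.comp hφ) with hψ
  have e1 := congrArg (fun T : TemperedDistribution ℝ ℂ => T ψ)
    (Lp.fourierInv_toTemperedDistribution_eq (h2.toLp G))
  simp only [TemperedDistribution.fourierInv_apply, Lp.toTemperedDistribution_apply] at e1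
  have e2 : ∫ x, 𝓕⁻ (ψ : ℝ → ℂ) x • G x = ∫ x, ψ x • 𝓕⁻ G x := by
    have := VectorFourier.integral_fourierIntegral_smul_eq_flip (L := -innerₗ ℝ) (f := ψ) (g := G)
      Real.continuous_fourierChar continuous_inner.neg ψ.integrable h1 (μ := volume) (ν := volume)
    rw [show (-innerₗ ℝ).flip = -innerₗ ℝ by ext; simp] at this
    exact this
  have e3 : ∫ x, (𝓕⁻ ψ) x • (h2.toLp G) x = ∫ x, 𝓕⁻ (ψ : ℝ → ℂ) x • G x := by
    refine integral_congr_ae ?_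
    filter_upwards [h2.coeFn_toLp] with x hx
    rw [hx, SchwartzMap.fourierInv_coe]
  have e4 : ∀ H : ℝ → ℂ, ∫ x, φ x • H x = ∫ x, ψ x • H x := fun H => rfl
  rw [e4, e4, ← e1, e3, e2]

theorem Lp_two_enorm_sq (f : Lp ℂ 2 (volume : Measure ℝ)) : ‖f‖ₑ ^ 2 = ∫⁻ x, ‖f x‖ₑ ^ 2 := by
  have := eLpNorm_nnreal_pow_eq_lintegral (μ := volume) (f := f) (p := 2) (by norm_num)
  rw [Lp.enorm_def]
  simpa using this

theorem toLp_two_enorm_sq {G : ℝ → ℂ} (h2 : MemLp G 2 volume) :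
    ‖h2.toLp G‖ₑ ^ 2 = ∫⁻ x, ‖G x‖ₑ ^ 2 := by
  rw [Lp_two_enorm_sq]
  refine lintegral_congr_ae ?_
  filter_upwards [h2.coeFn_toLp] with x hx
  rw [hx]

theorem Lp_two_enorm_fourierInv (f : Lp ℂ 2 (volume : Measure ℝ)) : ‖𝓕⁻ f‖ₑ = ‖f‖ₑ := by
  have h := (Lp.norm_fourier_eq (𝓕⁻ f)).symm
  rw [FourierTransform.fourier_fourierInv_eq] at h
  rw [← ofReal_norm, ← ofReal_norm, h]

/-- Plancherel's theorem for functions in `L¹ ∩ L²`. -/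
theorem lintegral_enorm_fourierInv_sq {G : ℝ → ℂ} (h1 : Integrable G) (h2 : MemLp G 2 volume) :
    ∫⁻ x, ‖𝓕⁻ G x‖ₑ ^ 2 = ∫⁻ x, ‖G x‖ₑ ^ 2 := by
  rw [← toLp_two_enorm_sq h2, ← Lp_two_enorm_fourierInv, Lp_two_enorm_sq]
  refine lintegral_congr_ae ?_
  filter_upwards [fourierInv_toLp_ae_eq h1 h2] with x hx
  rw [hx]

/-- A sequence converging fast enough in `L²` converges almost everywhere. -/
theorem ae_tendsto_of_tsum_lintegral_ne_top {f : ℕ → ℝ → ℂ} {g : ℝ → ℂ}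
    (hf : ∀ n, AEStronglyMeasurable (f n) volume) (hg : AEStronglyMeasurable g volume)
    (h : ∑' n, ∫⁻ x, ‖f n x - g x‖ₑ ^ 2 ≠ ∞) :
    ∀ᵐ x, Filter.Tendsto (fun n => f n x) Filter.atTop (nhds (g x)) := by
  have hm : ∀ n, AEMeasurable (fun x => ‖f n x - g x‖ₑ ^ 2) volume :=
    fun n => ((hf n).sub hg).enorm.pow_const 2
  rw [← lintegral_tsum hm] at h
  filter_upwards [ae_lt_top' (AEMeasurable.tsum hm) h] with x hx
  have h1 := ENNReal.tendsto_atTop_zero_of_tsum_ne_top hx.ne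
  rw [tendsto_iff_enorm_sub_tendsto_zero]
  have h2 := (ENNReal.continuous_rpow_const (y := 1 / 2)).continuousAt.tendsto.comp h1
  rw [ENNReal.zero_rpow_of_pos (by norm_num)] at h2
  refine h2.congr fun n => ?_
  simp only [Function.comp]
  rw [← ENNReal.rpow_natCast, ← ENNReal.rpow_mul]
  norm_num

/-! ### Cylindrical coordinates and tensor cubes -/

/-- Cylindrical coordinates around the diagonal of `ℝ³`: the point with coordinate sum `s` whose
displacement from the diagonal is described by the complex number `z`. -/
noncomputable def cylCoord : (ℝ × ℂ) ≃ₗ[ℝ] ℝ × ℝ × ℝ where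
  toFun p := (p.1 / 3 + 2 * p.2.re, p.1 / 3 - p.2.re - √3 * p.2.im,
    p.1 / 3 - p.2.re + √3 * p.2.im)
  map_add' p q := by ext <;> simp <;> ring
  map_smul' c p := by ext <;> simp <;> ring
  invFun y := (y.1 + y.2.1 + y.2.2,
    ⟨(y.1 - (y.1 + y.2.1 + y.2.2) / 3) / 2, (y.2.2 - y.2.1) / (2 * √3)⟩)
  left_inv p := by
    have : √3 ≠ 0 := by positivity
    refine Prod.ext ?_ (Complex.ext ?_ ?_)
    · simp; ring
    · simp; ring
    · simp; field_simp; ring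
  right_inv y := by
    have : √3 ≠ 0 := by positivity
    ext
    · simp; ring
    · simp; field_simp; ring
    · simp; field_simp; ring

theorem continuous_cylCoord : Continuous cylCoord :=
  cylCoord.toLinearMap.continuous_of_finiteDimensional

theorem continuous_cylCoord_symm : Continuous cylCoord.symm :=
  cylCoord.symm.toLinearMap.continuous_of_finiteDimensional

theorem cylCoord_sum (p : ℝ × ℂ) :
    (cylCoord p).1 + (cylCoord p).2.1 + (cylCoord p).2.2 = p.1 := by
  simp [cylCoord]; ring

/-- The vectors `(1, 1, 1) / 3`, `(2, -1, -1)` and `(0, -√3, √3)` behind the coordinates are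
orthogonal, of squared lengths `1/3`, `6` and `6`. Equal lengths in the plane make multiplication of
`z` by a unit complex number a Euclidean rotation. -/
theorem cylCoord_inner (p q : ℝ × ℂ) :
    (cylCoord p).1 * (cylCoord q).1 + (cylCoord p).2.1 * (cylCoord q).2.1
      + (cylCoord p).2.2 * (cylCoord q).2.2
      = p.1 * q.1 / 3 + 6 * (p.2 * (starRingEnd ℂ) q.2).re := by
  have h3 : √3 * √3 = 3 := Real.mul_self_sqrt (by norm_num)
  simp [cylCoord]
  linear_combination (2 * p.2.im * q.2.im) * h3

theorem cylCoord_sq_sum (p : ℝ × ℂ) :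
    (cylCoord p).1 ^ 2 + (cylCoord p).2.1 ^ 2 + (cylCoord p).2.2 ^ 2
      = p.1 ^ 2 / 3 + 6 * ‖p.2‖ ^ 2 := by
  have := cylCoord_inner p p
  rw [Complex.mul_conj, Complex.ofReal_re, Complex.normSq_eq_norm_sq] at this
  linear_combination this

/-- The cylindrical coordinates as a homeomorphism. -/
noncomputable def cylHomeo : (ℝ × ℂ) ≃ₜ ℝ × ℝ × ℝ where
  toEquiv := cylCoord.toEquiv
  continuous_toFun := continuous_cylCoord
  continuous_invFun := continuous_cylCoord_symm

/-- Uniqueness of Haar measure suffices: the value of the Jacobian is never needed, since the sharp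
constant is only compared with itself. -/
theorem exists_map_cylCoord : ∃ κ : ℝ, 0 < κ ∧
    (volume : Measure (ℝ × ℂ)).map cylCoord = ENNReal.ofReal κ • volume := by
  have i1 : (volume : Measure (ℝ × ℂ)).IsAddHaarMeasure :=
    inferInstanceAs (Measure.prod volume volume).IsAddHaarMeasure
  have i2 : (volume : Measure (ℝ × ℝ)).IsAddHaarMeasure :=
    inferInstanceAs (Measure.prod volume volume).IsAddHaarMeasure
  have i3 : (volume : Measure (ℝ × ℝ × ℝ)).IsAddHaarMeasure :=
    inferInstanceAs (Measure.prod volume volume).IsAddHaarMeasure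
  have hh : (Measure.map cylCoord (volume : Measure (ℝ × ℂ))).IsAddHaarMeasure :=
    cylCoord.toContinuousLinearEquiv.isAddHaarMeasure_map volume
  refine ⟨(Measure.addHaarScalarFactor (Measure.map cylCoord volume)
      (volume : Measure (ℝ × ℝ × ℝ)) : ℝ), ?_,
    (Measure.isAddLeftInvariant_eq_smul (Measure.map cylCoord volume) volume).trans ?_⟩
  · exact_mod_cast Measure.addHaarScalarFactor_pos_of_isAddHaarMeasure _ _
  · rw [ENNReal.ofReal_coe_nnreal]; rfl

/-- The Jacobian of the cylindrical coordinates. -/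
noncomputable def cylJac : ℝ := exists_map_cylCoord.choose

theorem cylJac_pos : 0 < cylJac := exists_map_cylCoord.choose_spec.1

theorem map_cylCoord :
    (volume : Measure (ℝ × ℂ)).map cylCoord = ENNReal.ofReal cylJac • volume :=
  exists_map_cylCoord.choose_spec.2

theorem lintegral_comp_cylCoord (F : ℝ × ℝ × ℝ → ℝ≥0∞) :
    ∫⁻ p, F (cylCoord p) = ENNReal.ofReal cylJac * ∫⁻ y, F y := by
  rw [← smul_eq_mul, ← lintegral_smul_measure, ← map_cylCoord]
  exact (cylHomeo.measurableEmbedding.lintegral_map F).symm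

theorem integral_comp_cylCoord (F : ℝ × ℝ × ℝ → ℂ) :
    ∫ p, F (cylCoord p) = (cylJac : ℂ) * ∫ y, F y := by
  have : ∫ y, F y ∂(ENNReal.ofReal cylJac • volume) = (cylJac : ℂ) * ∫ y, F y := by
    rw [integral_smul_measure, ENNReal.toReal_ofReal cylJac_pos.le]; simp
  rw [← this, ← map_cylCoord]
  exact (cylHomeo.measurableEmbedding.integral_map F).symm

theorem quasiMeasurePreserving_cylCoord : Measure.QuasiMeasurePreserving cylCoord :=
  ⟨continuous_cylCoord.measurable, by
    rw [map_cylCoord]; exact Measure.smul_absolutelyContinuous⟩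

/-- The triple tensor product `g ⊗ g ⊗ g` on `ℝ³`. -/
noncomputable def tensorCube (g : ℝ → ℂ) (y : ℝ × ℝ × ℝ) : ℂ := g y.1 * g y.2.1 * g y.2.2

theorem tendsto_tensorCube_ae {g : ℕ → ℝ → ℂ} {g' : ℝ → ℂ}
    (h : ∀ᵐ x, Filter.Tendsto (fun n => g n x) Filter.atTop (nhds (g' x))) :
    ∀ᵐ y, Filter.Tendsto (fun n => tensorCube (g n) y) Filter.atTop
      (nhds (tensorCube g' y)) := by
  have h2 : Measure.QuasiMeasurePreserving (fun y : ℝ × ℝ × ℝ => y.2.1) :=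
    Measure.quasiMeasurePreserving_fst.comp Measure.quasiMeasurePreserving_snd
  have h3 : Measure.QuasiMeasurePreserving (fun y : ℝ × ℝ × ℝ => y.2.2) :=
    Measure.quasiMeasurePreserving_snd.comp Measure.quasiMeasurePreserving_snd
  filter_upwards [Measure.quasiMeasurePreserving_fst.ae h, h2.ae h, h3.ae h] with y a b c
  exact (a.mul b).mul c

theorem lintegral_enorm_tensorCube_sq {g : ℝ → ℂ} (h : AEStronglyMeasurable g volume) :
    ∫⁻ y, ‖tensorCube g y‖ₑ ^ 2 = (∫⁻ x, ‖g x‖ₑ ^ 2) ^ 3 := by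
  have hm := h.enorm.pow_const 2
  have e : ∀ y : ℝ × ℝ × ℝ, ‖tensorCube g y‖ₑ ^ 2
      = ‖g y.1‖ₑ ^ 2 * (‖g y.2.1‖ₑ ^ 2 * ‖g y.2.2‖ₑ ^ 2) := fun y => by
    rw [tensorCube, enorm_mul, enorm_mul]; ring
  simp_rw [e]
  rw [Measure.volume_eq_prod, lintegral_prod_mul (g := fun y : ℝ × ℝ => ‖g y.1‖ₑ ^ 2 * ‖g y.2‖ₑ ^ 2)
    hm, Measure.volume_eq_prod, lintegral_prod_mul hm hm]
  · ring
  · exact (hm.comp_quasiMeasurePreserving Measure.quasiMeasurePreserving_fst).mul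
      (hm.comp_quasiMeasurePreserving Measure.quasiMeasurePreserving_snd)

theorem integral_tensorCube (g : ℝ → ℂ) : ∫ y, tensorCube g y = (∫ x, g x) ^ 3 := by
  have e : ∀ y : ℝ × ℝ × ℝ, tensorCube g y = g y.1 * (g y.2.1 * g y.2.2) := fun y => by
    rw [tensorCube]; ring
  simp_rw [e]
  rw [Measure.volume_eq_prod, integral_prod_mul (g := fun y : ℝ × ℝ => g y.1 * g y.2),
    Measure.volume_eq_prod, integral_prod_mul]
  ring

/-! ### Rotations, circle integrals and the rotation defect -/

/-- The rotation by the angle `θ` around the diagonal, in cylindrical coordinates. -/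
noncomputable def cylRot (θ : ℝ) (p : ℝ × ℂ) : ℝ × ℂ := (p.1, Complex.exp (θ * Complex.I) * p.2)

theorem measurePreserving_cylRot (θ : ℝ) : MeasurePreserving (cylRot θ) := by
  have h := (rotation (Circle.exp θ)).measurePreserving
  exact (MeasurePreserving.id (volume : Measure ℝ)).prod h

theorem continuous_cylRot : Continuous fun q : ℝ × ℝ × ℂ => cylRot q.1 q.2 := by
  unfold cylRot; fun_prop

theorem measurableEmbedding_cylRot (θ : ℝ) : MeasurableEmbedding (cylRot θ) := by
  refine (measurePreserving_cylRot θ).measurable.measurableEmbedding fun p q h => ?_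
  simp only [cylRot, Prod.mk.injEq, mul_eq_mul_left_iff, Complex.exp_ne_zero, or_false] at h
  exact Prod.ext h.1 h.2

theorem enorm_sq_eq_ofReal (w : ℂ) : ‖w‖ₑ ^ 2 = ENNReal.ofReal (‖w‖ ^ 2) := by
  rw [← ofReal_norm, ENNReal.ofReal_pow (norm_nonneg w)]

theorem lintegral_Ioo_eq_ofReal {b : ℝ → ℝ} (hb : Continuous b) (h0 : ∀ x, 0 ≤ b x) :
    ∫⁻ θ in Set.Ioo (-Real.pi) Real.pi, ENNReal.ofReal (b θ)
      = ENNReal.ofReal (∫ θ in -Real.pi..Real.pi, b θ) := by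
  have hpi : -Real.pi ≤ Real.pi := by linarith [Real.pi_pos]
  rw [intervalIntegral.integral_of_le hpi, integral_Ioc_eq_integral_Ioo,
    ofReal_integral_eq_lintegral_ofReal _ (Filter.Eventually.of_forall h0)]
  exact (hb.integrableOn_Icc (a := -Real.pi) (b := Real.pi)).mono_set Set.Ioo_subset_Icc_self

/-- The variance identity: after expanding the square, the cross term integrates to the squared norm
of the integral. -/
theorem integral_integral_norm_sub_sq {a : ℝ → ℂ} (ha : Continuous a) (l r : ℝ) :
    ∫ φ in l..r, ∫ θ in l..r, ‖a φ - a θ‖ ^ 2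
      = 2 * (r - l) * (∫ θ in l..r, ‖a θ‖ ^ 2) - 2 * ‖∫ θ in l..r, a θ‖ ^ 2 := by
  have hi : ∀ x : ℂ, ∫ θ in l..r, inner ℝ x (a θ) = inner ℝ x (∫ θ in l..r, a θ) := fun x =>
    (innerSL ℝ x).intervalIntegral_comp_comm (ha.intervalIntegrable l r)
  have hi' : ∫ φ in l..r, inner ℝ (a φ) (∫ θ in l..r, a θ) = ‖∫ θ in l..r, a θ‖ ^ 2 := by
    rw [← real_inner_self_eq_norm_sq, ← hi]
    exact intervalIntegral.integral_congr fun φ _ => real_inner_comm _ _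
  have h1 : ∀ φ, ∫ θ in l..r, ‖a φ - a θ‖ ^ 2
      = (r - l) * ‖a φ‖ ^ 2 - 2 * inner ℝ (a φ) (∫ θ in l..r, a θ)
        + ∫ θ in l..r, ‖a θ‖ ^ 2 := fun φ => by
    simp_rw [norm_sub_sq_real]
    rw [intervalIntegral.integral_add, intervalIntegral.integral_sub,
      intervalIntegral.integral_const, intervalIntegral.integral_const_mul, hi, smul_eq_mul]
    all_goals exact Continuous.intervalIntegrable (by fun_prop) _ _
  simp_rw [h1]
  rw [intervalIntegral.integral_add, intervalIntegral.integral_sub,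
    intervalIntegral.integral_const, intervalIntegral.integral_const_mul,
    intervalIntegral.integral_const_mul, hi', smul_eq_mul]
  · ring
  all_goals exact Continuous.intervalIntegrable (by fun_prop) _ _

/-- For a function on the circle, the distance to its rotates is controlled by the distance to
its mean. -/
theorem lintegral_circle_identity {a : ℝ → ℂ} (ha : Continuous a)
    (hp : Function.Periodic a (2 * Real.pi)) :
    (∫⁻ φ in Set.Ioo (-Real.pi) Real.pi, ∫⁻ θ in Set.Ioo (-Real.pi) Real.pi,
        ‖a φ - a (φ + θ)‖ₑ ^ 2)
      + 2 * ‖∫ φ in Set.Ioo (-Real.pi) Real.pi, a φ‖ₑ ^ 2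
      = ENNReal.ofReal (4 * Real.pi) * ∫⁻ φ in Set.Ioo (-Real.pi) Real.pi, ‖a φ‖ₑ ^ 2 := by
  have hpi : -Real.pi ≤ Real.pi := by linarith [Real.pi_pos]
  have h1 : ∀ φ, ∫⁻ θ in Set.Ioo (-Real.pi) Real.pi, ‖a φ - a (φ + θ)‖ₑ ^ 2
      = ENNReal.ofReal (∫ θ in -Real.pi..Real.pi, ‖a φ - a θ‖ ^ 2) := fun φ => by
    simp_rw [enorm_sq_eq_ofReal]
    rw [lintegral_Ioo_eq_ofReal (by fun_prop) (fun _ => by positivity)]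
    -- By periodicity the shift `θ ↦ φ + θ` can be undone without changing the interval.
    congr 1
    have hq : Function.Periodic (fun θ => ‖a φ - a θ‖ ^ 2) (2 * Real.pi) := fun θ => by
      simp only [hp θ]
    have := hq.intervalIntegral_add_eq (φ + -Real.pi) (-Real.pi)
    rw [show φ + -Real.pi + 2 * Real.pi = φ + Real.pi by ring,
      show -Real.pi + 2 * Real.pi = Real.pi by ring] at this
    rw [← this]
    exact intervalIntegral.integral_comp_add_left (fun θ => ‖a φ - a θ‖ ^ 2) φ
  simp_rw [h1, enorm_sq_eq_ofReal]
  rw [lintegral_Ioo_eq_ofReal, lintegral_Ioo_eq_ofReal (by fun_prop) (fun _ => by positivity),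
    integral_integral_norm_sub_sq ha, ← integral_Ioc_eq_integral_Ioo,
    ← intervalIntegral.integral_of_le hpi, ← ENNReal.ofReal_mul (by positivity),
    show (2 : ℝ≥0∞) = ENNReal.ofReal 2 by simp, ← ENNReal.ofReal_mul (by positivity),
    ← ENNReal.ofReal_add]
  · congr 1; ring
  · rw [← integral_integral_norm_sub_sq ha]
    exact intervalIntegral.integral_nonneg hpi fun _ _ =>
      intervalIntegral.integral_nonneg hpi fun _ _ => by positivity
  · positivity
  · exact intervalIntegral.continuous_parametric_intervalIntegral_of_continuous' (by fun_prop) _ _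
  · exact fun _ => intervalIntegral.integral_nonneg hpi fun _ _ => by positivity

/-- `g ⊗ g ⊗ g` in cylindrical coordinates. -/
noncomputable def cylCube (g : ℝ → ℂ) (p : ℝ × ℂ) : ℂ := tensorCube g (cylCoord p)

theorem continuous_cylCube {g : ℝ → ℂ} (hg : Continuous g) : Continuous (cylCube g) := by
  have : Continuous (tensorCube g) := by unfold tensorCube; fun_prop
  exact this.comp continuous_cylCoord

/-- How far `g ⊗ g ⊗ g` is from being invariant under the rotations around the diagonal. -/
noncomputable def rotDefect (g : ℝ → ℂ) : ℝ≥0∞ :=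
  ∫⁻ θ in Set.Ioo (-Real.pi) Real.pi, ∫⁻ p, ‖cylCube g p - cylCube g (cylRot θ p)‖ₑ ^ 2

/-- The integral of `g ⊗ g ⊗ g` over a circle around the diagonal. -/
noncomputable def circleInt (g : ℝ → ℂ) (s r : ℝ) : ℂ :=
  ∫ φ in Set.Ioo (-Real.pi) Real.pi, cylCube g (s, r * Complex.exp (φ * Complex.I))

theorem continuous_circleInt {g : ℝ → ℂ} (hg : Continuous g) :
    Continuous fun q : ℝ × ℝ => circleInt g q.1 q.2 := by
  have hpi : -Real.pi ≤ Real.pi := by linarith [Real.pi_pos]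
  have hc := continuous_cylCube hg
  simp_rw [circleInt, ← integral_Ioc_eq_integral_Ioo, ← intervalIntegral.integral_of_le hpi]
  exact intervalIntegral.continuous_parametric_intervalIntegral_of_continuous' (by fun_prop) _ _

theorem lintegral_polar {f : ℝ × ℂ → ℝ≥0∞} (hf : Measurable f) :
    ∫⁻ p, f p = ∫⁻ s : ℝ, ∫⁻ r in Set.Ioi (0 : ℝ), ENNReal.ofReal r *
      ∫⁻ φ in Set.Ioo (-Real.pi) Real.pi, f (s, r * Complex.exp (φ * Complex.I)) := by
  rw [Measure.volume_eq_prod, lintegral_prod _ hf.aemeasurable]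
  refine lintegral_congr fun s => ?_
  have hm : Measurable fun q : ℝ × ℝ => f (s, q.1 * Complex.exp (q.2 * Complex.I)) :=
    hf.comp (Continuous.measurable (by fun_prop))
  rw [← Complex.lintegral_comp_polarCoord_symm, polarCoord_target,
    Measure.volume_eq_prod, ← Measure.prod_restrict, lintegral_prod]
  · refine lintegral_congr fun r => ?_
    rw [← lintegral_const_mul _ (by exact hm.comp (by fun_prop : Measurable fun φ : ℝ => (r, φ)))]
    refine lintegral_congr fun φ => ?_
    simp only [Complex.polarCoord_symm_apply, smul_eq_mul, Complex.exp_mul_I]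
    push_cast; rfl
  · refine Measurable.aemeasurable ?_
    simp only [Complex.polarCoord_symm_apply, smul_eq_mul]
    refine (by fun_prop : Measurable fun q : ℝ × ℝ => ENNReal.ofReal q.1).mul ?_
    convert hm using 4
    rw [Complex.exp_mul_I]; push_cast; rfl

theorem lintegral_lintegral_const_mul {μ ν : Measure ℝ} [SFinite ν] (c : ℝ≥0∞)
    {F : ℝ → ℝ → ℝ≥0∞} (hF : Measurable (Function.uncurry F)) :
    c * ∫⁻ s, ∫⁻ r, F s r ∂ν ∂μ = ∫⁻ s, ∫⁻ r, c * F s r ∂ν ∂μ := by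
  rw [← lintegral_const_mul _ hF.lintegral_prod_right]
  exact lintegral_congr fun s => (lintegral_const_mul _ hF.of_uncurry_left).symm

theorem lintegral_lintegral_add {μ ν : Measure ℝ} [SFinite ν]
    {F : ℝ → ℝ → ℝ≥0∞} (G : ℝ → ℝ → ℝ≥0∞) (hF : Measurable (Function.uncurry F)) :
    ∫⁻ s, ∫⁻ r, G s r ∂ν ∂μ + ∫⁻ s, ∫⁻ r, F s r ∂ν ∂μ = ∫⁻ s, ∫⁻ r, G s r + F s r ∂ν ∂μ := by
  rw [← lintegral_add_right _ hF.lintegral_prod_right]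
  exact lintegral_congr fun s => (lintegral_add_right _ hF.of_uncurry_left).symm

/-- This is `lintegral_circle_identity` on each circle, integrated against `r dr ds`. It measures
the exact loss in Cauchy–Schwarz for the circle integrals. -/
theorem rotDefect_add {g : ℝ → ℂ} (hg : Continuous g) :
    rotDefect g + 2 * ∫⁻ s : ℝ, ∫⁻ r in Set.Ioi (0 : ℝ), ENNReal.ofReal r * ‖circleInt g s r‖ₑ ^ 2
      = ENNReal.ofReal (4 * Real.pi) * (ENNReal.ofReal cylJac * (∫⁻ x, ‖g x‖ₑ ^ 2) ^ 3) := by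
  have hc := continuous_cylCube hg
  have hA := continuous_circleInt hg
  have hrot : ∀ s r φ θ : ℝ, cylRot θ (s, r * Complex.exp (φ * Complex.I))
      = (s, r * Complex.exp ((φ + θ : ℝ) * Complex.I)) := fun s r φ θ => by
    simp only [cylRot]
    congr 1
    push_cast
    rw [add_mul, Complex.exp_add]; ring
  rw [← lintegral_enorm_tensorCube_sq hg.aestronglyMeasurable, ← lintegral_comp_cylCoord]
  change _ = _ * ∫⁻ p, ‖cylCube g p‖ₑ ^ 2
  have hrc := continuous_cylRot
  have hcont : Continuous fun q : (ℝ × ℂ) × ℝ =>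
      ‖cylCube g q.1 - cylCube g (cylRot q.2 q.1)‖ₑ ^ 2 := by
    have : Continuous fun q : (ℝ × ℂ) × ℝ => cylRot q.2 q.1 :=
      hrc.comp (by fun_prop : Continuous fun q : (ℝ × ℂ) × ℝ => (q.2, q.1))
    fun_prop
  have hmA : Measurable (Function.uncurry fun s r : ℝ =>
      ENNReal.ofReal r * ‖circleInt g s r‖ₑ ^ 2) :=
    Measurable.mul (f := fun q : ℝ × ℝ => ENNReal.ofReal q.2) (by fun_prop)
      (hA.measurable.enorm.pow_const 2)
  have hswap := lintegral_lintegral_swap (μ := volume.restrict (Set.Ioo (-Real.pi) Real.pi))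
    (ν := volume) (f := fun θ p => ‖cylCube g p - cylCube g (cylRot θ p)‖ₑ ^ 2)
    (Continuous.aemeasurable (hcont.comp continuous_swap))
  rw [rotDefect, hswap, lintegral_polar hcont.measurable.lintegral_prod_right',
    lintegral_polar (Continuous.measurable (by fun_prop)),
    lintegral_lintegral_const_mul (F := fun s r => ENNReal.ofReal r * ‖circleInt g s r‖ₑ ^ 2)
      _ hmA,
    lintegral_lintegral_const_mul, lintegral_lintegral_add]
  rotate_left
  · exact hmA.const_mul 2
  · refine Measurable.mul (by fun_prop) (Measurable.lintegral_prod_right'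
      (f := fun u : (ℝ × ℝ) × ℝ =>
        ‖cylCube g (u.1.1, u.1.2 * Complex.exp (u.2 * Complex.I))‖ₑ ^ 2) ?_)
    exact Continuous.measurable (by fun_prop)
  have key : ∀ s r : ℝ, (ENNReal.ofReal r * ∫⁻ φ in Set.Ioo (-Real.pi) Real.pi,
      ∫⁻ θ in Set.Ioo (-Real.pi) Real.pi, ‖cylCube g (s, r * Complex.exp (φ * Complex.I))
          - cylCube g (cylRot θ (s, r * Complex.exp (φ * Complex.I)))‖ₑ ^ 2)
      + 2 * (ENNReal.ofReal r * ‖circleInt g s r‖ₑ ^ 2)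
      = ENNReal.ofReal (4 * Real.pi) * (ENNReal.ofReal r *
        ∫⁻ φ in Set.Ioo (-Real.pi) Real.pi,
          ‖cylCube g (s, r * Complex.exp (φ * Complex.I))‖ₑ ^ 2) := fun s r => by
    simp_rw [hrot]
    have hp : Function.Periodic (fun φ : ℝ => cylCube g (s, r * Complex.exp (φ * Complex.I)))
        (2 * Real.pi) := fun φ => by
      simp only
      congr 3
      have := Complex.exp_periodic (φ * Complex.I)
      rw [← this]; congr 1; push_cast; ring
    have := lintegral_circle_identity (by fun_prop) hp
    rw [mul_left_comm (ENNReal.ofReal (4 * Real.pi)), ← this, circleInt]; ring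
  exact lintegral_congr fun s => lintegral_congr fun r => key s r

/-! ### The cube of the wave and Plancherel in space and time -/

theorem integrable_of_gaussian_bound {H : ℝ → ℂ} (hm : AEStronglyMeasurable H volume) {b M : ℝ}
    (hb : 0 < b) (h : ∀ s, ‖H s‖ ≤ M * Real.exp (-b * s ^ 2)) : Integrable H :=
  ((integrable_exp_neg_mul_sq hb).const_mul M).mono' hm (Filter.Eventually.of_forall h)

theorem memLp_two_of_gaussian_bound {H : ℝ → ℂ} (hm : AEStronglyMeasurable H volume) {b M : ℝ}
    (hb : 0 < b) (h : ∀ s, ‖H s‖ ≤ M * Real.exp (-b * s ^ 2)) : MemLp H 2 volume := by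
  rw [memLp_two_iff_integrable_sq_norm hm]
  refine ((integrable_exp_neg_mul_sq (by positivity : 0 < 2 * b)).const_mul (M ^ 2)).mono'
    (hm.norm.pow 2) (Filter.Eventually.of_forall fun s => ?_)
  rw [Real.norm_of_nonneg (by positivity)]
  calc ‖H s‖ ^ 2 ≤ (M * Real.exp (-b * s ^ 2)) ^ 2 := by gcongr; exact h s
    _ = _ := by rw [mul_pow, ← Real.exp_nat_mul]; congr 2; push_cast; ring

theorem norm_cylCube_le {g : ℝ → ℂ} {M : ℝ} (h : ∀ η, ‖g η‖ ≤ M * Real.exp (-η ^ 2)) (p : ℝ × ℂ) :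
    ‖cylCube g p‖ ≤ M ^ 3 * Real.exp (-(1 / 3) * p.1 ^ 2) * Real.exp (-6 * ‖p.2‖ ^ 2) := by
  have hM : 0 ≤ M := by
    have := (norm_nonneg _).trans (h 0)
    simpa using this
  rw [cylCube, tensorCube, norm_mul, norm_mul]
  calc _ ≤ (M * Real.exp (-(cylCoord p).1 ^ 2)) * (M * Real.exp (-(cylCoord p).2.1 ^ 2))
        * (M * Real.exp (-(cylCoord p).2.2 ^ 2)) := by gcongr <;> apply h
    _ = M ^ 3 * Real.exp (-((cylCoord p).1 ^ 2 + (cylCoord p).2.1 ^ 2 + (cylCoord p).2.2 ^ 2)) := by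
      rw [neg_add, neg_add, Real.exp_add, Real.exp_add]; ring
    _ = _ := by
      rw [cylCoord_sq_sum, mul_assoc, ← Real.exp_add]; congr 2; ring

theorem integrable_exp_neg_norm_sq : Integrable fun z : ℂ => Real.exp (-6 * ‖z‖ ^ 2) := by
  have := (GaussianFourier.integrable_cexp_neg_mul_sq_norm_add (V := ℂ) (b := 6) (by simp) 0 0).norm
  refine this.congr (Filter.Eventually.of_forall fun z => ?_)
  simp only [Complex.norm_exp]
  congr 1
  norm_cast
  simp

/-- The integral of `g ⊗ g ⊗ g`, modulated by the Schrödinger phase, over a plane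
orthogonal to the diagonal. -/
noncomputable def planeInt (g : ℝ → ℂ) (t s : ℝ) : ℂ :=
  ∫ z : ℂ, Complex.exp (((24 * Real.pi ^ 2 * t * ‖z‖ ^ 2 : ℝ) : ℂ) * Complex.I) * cylCube g (s, z)

theorem norm_planeInt_le {g : ℝ → ℂ} {M : ℝ} (h : ∀ η, ‖g η‖ ≤ M * Real.exp (-η ^ 2)) (t s : ℝ) :
    ‖planeInt g t s‖ ≤
      (M ^ 3 * ∫ z : ℂ, Real.exp (-6 * ‖z‖ ^ 2)) * Real.exp (-(1 / 3) * s ^ 2) := by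
  rw [mul_right_comm, ← integral_const_mul]
  refine norm_integral_le_of_norm_le (integrable_exp_neg_norm_sq.const_mul _)
    (Filter.Eventually.of_forall fun z => ?_)
  rw [norm_mul, Complex.norm_exp_ofReal_mul_I, one_mul]
  exact norm_cylCube_le h (s, z)

theorem continuous_planeInt {g : ℝ → ℂ} (hg : Continuous g) {M : ℝ}
    (h : ∀ η, ‖g η‖ ≤ M * Real.exp (-η ^ 2)) :
    Continuous fun q : ℝ × ℝ => planeInt g q.1 q.2 := by
  have hM : 0 ≤ M := by
    have := (norm_nonneg _).trans (h 0)
    simpa using this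
  have hc := continuous_cylCube hg
  refine continuous_of_dominated (bound := fun z => M ^ 3 * Real.exp (-6 * ‖z‖ ^ 2))
    (fun q => Continuous.aestronglyMeasurable (by fun_prop))
    (fun q => Filter.Eventually.of_forall fun z => ?_) (integrable_exp_neg_norm_sq.const_mul _)
    (Filter.Eventually.of_forall fun z => by fun_prop)
  rw [norm_mul, Complex.norm_exp_ofReal_mul_I, one_mul]
  refine (norm_cylCube_le h (q.2, z)).trans ?_
  have : Real.exp (-(1 / 3) * q.2 ^ 2) ≤ 1 := Real.exp_le_one_iff.2 (by nlinarith [sq_nonneg q.2])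
  have h3 : 0 ≤ M ^ 3 := by positivity
  gcongr
  exact mul_le_of_le_one_right h3 this

/-- The function `e^{itΔ} f` written as a Fourier integral of `g = 𝓕 f`. -/
noncomputable def wave (g : ℝ → ℂ) (t x : ℝ) : ℂ := 𝓕⁻ (fun η => schrodingerPhase t η * g η) x

/-- The cube is an integral over `ℝ³` with phase `2πsx + 4π²t(s²/3 + 6‖z‖²)` in cylindrical
coordinates. Since `x` meets only `s`, integrating over `z` first leaves a one-dimensional inverse
Fourier transform. -/
theorem wave_cube {g : ℝ → ℂ} (hg : Continuous g) {M : ℝ}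
    (h : ∀ η, ‖g η‖ ≤ M * Real.exp (-η ^ 2)) (t x : ℝ) :
    wave g t x ^ 3 = 𝓕⁻ (fun s => (cylJac : ℂ)⁻¹ *
      Complex.exp (((4 * Real.pi ^ 2 * t * s ^ 2 / 3 : ℝ) : ℂ) * Complex.I) * planeInt g t s) x := by
  set G : ℝ → ℂ := fun η => Complex.exp (((2 * Real.pi * (η * x) + 4 * Real.pi ^ 2 * t * η ^ 2 : ℝ)
    : ℂ) * Complex.I) * g η with hG
  have hw : wave g t x = ∫ η, G η := by
    rw [wave, Real.fourierInv_eq']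
    refine integral_congr_ae (Filter.Eventually.of_forall fun η => ?_)
    simp only [hG, schrodingerPhase, smul_eq_mul, ← mul_assoc, ← Complex.exp_add]
    congr 2
    simp
    ring
  have hGb : ∀ η, ‖G η‖ ≤ M * Real.exp (-η ^ 2) := fun η => by
    rw [hG, norm_mul, Complex.norm_exp_ofReal_mul_I, one_mul]; exact h η
  have hGc : Continuous G := by fun_prop
  have hGi : Integrable (cylCube G) := by
    refine Integrable.mono' (g := fun p : ℝ × ℂ => M ^ 3 * (Real.exp (-(1 / 3) * p.1 ^ 2) *
      Real.exp (-6 * ‖p.2‖ ^ 2))) (Integrable.const_mul ?_ _)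
      (continuous_cylCube hGc).aestronglyMeasurable
      (Filter.Eventually.of_forall fun p => (norm_cylCube_le hGb p).trans (by rw [mul_assoc]))
    exact (integrable_exp_neg_mul_sq (by norm_num : (0 : ℝ) < 1 / 3)).mul_prod
      integrable_exp_neg_norm_sq
  have hκ : (cylJac : ℂ) ≠ 0 := by exact_mod_cast cylJac_pos.ne'
  have h1 : wave g t x ^ 3 = (cylJac : ℂ)⁻¹ * ∫ p, cylCube G p := by
    rw [hw, ← integral_tensorCube, eq_inv_mul_iff_mul_eq₀ hκ, ← integral_comp_cylCoord]; rfl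
  have h2 : ∀ p, cylCube G p = Complex.exp (((2 * Real.pi * (p.1 * x)
      + 4 * Real.pi ^ 2 * t * p.1 ^ 2 / 3 + 24 * Real.pi ^ 2 * t * ‖p.2‖ ^ 2 : ℝ) : ℂ) * Complex.I)
      * cylCube g p := fun p => by
    have hs := cylCoord_sum p
    have hq := cylCoord_sq_sum p
    rw [show 2 * Real.pi * (p.1 * x) + 4 * Real.pi ^ 2 * t * p.1 ^ 2 / 3
        + 24 * Real.pi ^ 2 * t * ‖p.2‖ ^ 2
      = (2 * Real.pi * ((cylCoord p).1 * x) + 4 * Real.pi ^ 2 * t * (cylCoord p).1 ^ 2)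
        + (2 * Real.pi * ((cylCoord p).2.1 * x) + 4 * Real.pi ^ 2 * t * (cylCoord p).2.1 ^ 2)
        + (2 * Real.pi * ((cylCoord p).2.2 * x) + 4 * Real.pi ^ 2 * t * (cylCoord p).2.2 ^ 2) by
      linear_combination (-2 * Real.pi * x) * hs - (4 * Real.pi ^ 2 * t) * hq]
    simp only [cylCube, tensorCube, hG, Complex.ofReal_add (_ + _) (_ + _), add_mul,
      Complex.exp_add]
    ring
  rw [h1, Measure.volume_eq_prod, integral_prod _ hGi, ← integral_const_mul, Real.fourierInv_eq']
  refine integral_congr_ae (Filter.Eventually.of_forall fun s => ?_)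
  simp only [planeInt, smul_eq_mul]
  rw [← integral_const_mul, ← integral_const_mul, ← integral_const_mul]
  refine integral_congr_ae (Filter.Eventually.of_forall fun z => ?_)
  simp only [h2]
  push_cast
  simp only [add_mul, Complex.exp_add]
  simp
  ring_nf

/-- Plancherel in `x` at fixed `t`, applied to `wave_cube`; the phase in `s²` is unimodular and
drops out. -/
theorem lintegral_wave_pow_six {g : ℝ → ℂ} (hg : Continuous g) {M : ℝ}
    (h : ∀ η, ‖g η‖ ≤ M * Real.exp (-η ^ 2)) (t : ℝ) :
    ENNReal.ofReal (cylJac ^ 2) * ∫⁻ x, ‖wave g t x‖ₑ ^ 6 = ∫⁻ s, ‖planeInt g t s‖ₑ ^ 2 := by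
  set H : ℝ → ℂ := fun s => (cylJac : ℂ)⁻¹ *
      Complex.exp (((4 * Real.pi ^ 2 * t * s ^ 2 / 3 : ℝ) : ℂ) * Complex.I) * planeInt g t s with hH
  have hP : Continuous fun s => planeInt g t s :=
    (continuous_planeInt hg h).comp (by fun_prop : Continuous fun s : ℝ => (t, s))
  have hn : ∀ s, ‖H s‖ = cylJac⁻¹ * ‖planeInt g t s‖ := fun s => by
    simp only [hH]
    rw [norm_mul, norm_mul, Complex.norm_exp_ofReal_mul_I, mul_one, norm_inv, Complex.norm_real,
      Real.norm_of_nonneg cylJac_pos.le]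
  have hHc : Continuous H := by fun_prop
  have hb : ∀ s, ‖H s‖ ≤ (cylJac⁻¹ * (M ^ 3 * ∫ z : ℂ, Real.exp (-6 * ‖z‖ ^ 2))) *
      Real.exp (-(1 / 3) * s ^ 2) := fun s => by
    rw [hn, mul_assoc]
    have := norm_planeInt_le h t s
    have := cylJac_pos
    gcongr
  have key := lintegral_enorm_fourierInv_sq
    (integrable_of_gaussian_bound hHc.aestronglyMeasurable (by norm_num) hb)
    (memLp_two_of_gaussian_bound hHc.aestronglyMeasurable (by norm_num) hb)
  have e1 : ∀ x, ‖wave g t x‖ₑ ^ 6 = ‖𝓕⁻ H x‖ₑ ^ 2 := fun x => by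
    rw [← wave_cube hg h, enorm_pow, ← pow_mul]
  simp_rw [e1]
  rw [key, ← lintegral_const_mul _ (hHc.measurable.enorm.pow_const 2)]
  refine lintegral_congr fun s => ?_
  rw [enorm_sq_eq_ofReal, enorm_sq_eq_ofReal, ← ENNReal.ofReal_mul (by positivity), hn]
  congr 1
  have := cylJac_pos.ne'
  field_simp

theorem image_mul_sq_Ioi {c : ℝ} (hc : 0 < c) :
    (fun r : ℝ => c * r ^ 2) '' Set.Ioi 0 = Set.Ioi 0 := by
  ext σ
  simp only [Set.mem_image, Set.mem_Ioi]
  constructor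
  · rintro ⟨r, hr, rfl⟩; positivity
  · intro hσ
    refine ⟨√(σ / c), Real.sqrt_pos.2 (by positivity), ?_⟩
    rw [Real.sq_sqrt (by positivity)]; field_simp

theorem injOn_mul_sq_Ioi {c : ℝ} (hc : 0 < c) : Set.InjOn (fun r : ℝ => c * r ^ 2) (Set.Ioi 0) := by
  intro a ha b hb h
  have := mul_left_cancel₀ hc.ne' h
  exact (pow_left_inj₀ (le_of_lt ha) (le_of_lt hb) (by norm_num)).1 this

theorem hasDerivWithinAt_mul_sq (c r : ℝ) (s : Set ℝ) :
    HasDerivWithinAt (fun r : ℝ => c * r ^ 2) (2 * c * r) s r := by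
  have := ((hasDerivAt_pow 2 r).const_mul c).hasDerivWithinAt (s := s)
  rwa [show c * (((2 : ℕ) : ℝ) * r ^ (2 - 1)) = 2 * c * r by push_cast; ring] at this

theorem planeInt_eq_integral_circleInt {g : ℝ → ℂ} (hg : Continuous g) {M : ℝ}
    (h : ∀ η, ‖g η‖ ≤ M * Real.exp (-η ^ 2)) (t s : ℝ) :
    planeInt g t s = ∫ r in Set.Ioi (0 : ℝ), (r : ℂ) *
      (Complex.exp (((24 * Real.pi ^ 2 * t * r ^ 2 : ℝ) : ℂ) * Complex.I) * circleInt g s r) := by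
  have hc := continuous_cylCube hg
  rw [planeInt, ← Complex.integral_comp_polarCoord_symm, polarCoord_target,
    Measure.volume_eq_prod, ← Measure.prod_restrict]
  have e : ∀ q : ℝ × ℝ, q.1 • (Complex.exp
      (((24 * Real.pi ^ 2 * t * ‖Complex.polarCoord.symm q‖ ^ 2 : ℝ) : ℂ) * Complex.I) *
        cylCube g (s, Complex.polarCoord.symm q))
      = q.1 * (Complex.exp (((24 * Real.pi ^ 2 * t * q.1 ^ 2 : ℝ) : ℂ) * Complex.I) *
        cylCube g (s, q.1 * Complex.exp (q.2 * Complex.I))) := fun q => by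
    rw [Complex.norm_polarCoord_symm, sq_abs, Complex.polarCoord_symm_apply, Complex.exp_mul_I q.2,
      Complex.real_smul]
    push_cast; rfl
  simp_rw [e]
  rw [integral_prod]
  · refine integral_congr_ae (Filter.Eventually.of_forall fun r => ?_)
    simp only [circleInt]
    rw [← integral_const_mul, ← integral_const_mul]
  · have h1 : Integrable (fun r : ℝ => ‖(r : ℝ)‖ * Real.exp (-6 * r ^ 2))
        (volume.restrict (Set.Ioi 0)) := by
      have := (integrable_mul_exp_neg_mul_sq (by norm_num : (0 : ℝ) < 6)).norm.integrableOn
        (s := Set.Ioi 0)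
      refine this.congr (Filter.Eventually.of_forall fun r => ?_)
      simp
    have h2 : Integrable (fun _ : ℝ => M ^ 3 * Real.exp (-(1 / 3) * s ^ 2))
        (volume.restrict (Set.Ioo (-Real.pi) Real.pi)) := integrable_const _
    refine (h1.mul_prod h2).mono' (Continuous.aestronglyMeasurable (by fun_prop))
      (Filter.Eventually.of_forall fun q => ?_)
    rw [norm_mul, norm_mul, Complex.norm_exp_ofReal_mul_I, one_mul, Complex.norm_real, mul_assoc]
    refine mul_le_mul_of_nonneg_left ?_ (norm_nonneg _)
    refine (norm_cylCube_le h _).trans (le_of_eq ?_)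
    rw [norm_mul, Complex.norm_exp_ofReal_mul_I, mul_one, Complex.norm_real, Real.norm_eq_abs,
      sq_abs]
    ring

theorem norm_circleInt_le {g : ℝ → ℂ} {M : ℝ} (h : ∀ η, ‖g η‖ ≤ M * Real.exp (-η ^ 2)) (s r : ℝ) :
    ‖circleInt g s r‖ ≤
      (M ^ 3 * Real.exp (-(1 / 3) * s ^ 2) * (2 * Real.pi)) * Real.exp (-6 * r ^ 2) := by
  have hv : volume.real (Set.Ioo (-Real.pi) Real.pi) = 2 * Real.pi := by
    rw [Real.volume_real_Ioo_of_le (by linarith [Real.pi_pos])]; ring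
  refine (norm_setIntegral_le_of_norm_le_const (C := M ^ 3 * Real.exp (-(1 / 3) * s ^ 2) *
    Real.exp (-6 * r ^ 2)) (by simp) fun φ _ => ?_).trans (le_of_eq (by rw [hv]; ring))
  refine (norm_cylCube_le h _).trans (le_of_eq ?_)
  rw [norm_mul, Complex.norm_exp_ofReal_mul_I, mul_one, Complex.norm_real, Real.norm_eq_abs,
      sq_abs]

/-- Plancherel in `t`. The substitution `σ = 12πr²` turns the phase `24π²tr²` into `2πσt`, and `dσ =
24πr dr` supplies the constant. As a function of `t`, the plane integral is thus an inverse Fourier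
transform of circle integrals supported on `σ > 0`. -/
theorem lintegral_planeInt_sq {g : ℝ → ℂ} (hg : Continuous g) {M : ℝ}
    (h : ∀ η, ‖g η‖ ≤ M * Real.exp (-η ^ 2)) (s : ℝ) :
    ENNReal.ofReal (24 * Real.pi) * ∫⁻ t, ‖planeInt g t s‖ₑ ^ 2 =
      ∫⁻ r in Set.Ioi (0 : ℝ), ENNReal.ofReal r * ‖circleInt g s r‖ₑ ^ 2 := by
  have hpi := Real.pi_pos
  have hc : (0 : ℝ) < 12 * Real.pi := by positivity
  have hA : Continuous fun r => circleInt g s r :=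
    (continuous_circleInt hg).comp (by fun_prop : Continuous fun r : ℝ => (s, r))
  set b : ℝ → ℂ := fun σ => ((24 * Real.pi : ℝ) : ℂ)⁻¹ * circleInt g s (√(σ / (12 * Real.pi)))
    with hb
  have hbc : Continuous b := by fun_prop
  set B : ℝ → ℂ := (Set.Ioi (0 : ℝ)).indicator b with hB
  have hbv : ∀ r ∈ Set.Ioi (0 : ℝ), b (12 * Real.pi * r ^ 2)
      = ((24 * Real.pi : ℝ) : ℂ)⁻¹ * circleInt g s r := fun r hr => by
    simp only [hb]
    rw [mul_div_cancel_left₀ _ hc.ne', Real.sqrt_sq (le_of_lt hr)]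
  have hF : ∀ t, planeInt g t s = 𝓕⁻ B t := fun t => by
    rw [planeInt_eq_integral_circleInt hg h, Real.fourierInv_eq']
    have e : ∀ v, Complex.exp (((2 * Real.pi * inner ℝ v t : ℝ) : ℂ) * Complex.I) • B v
        = (Set.Ioi (0 : ℝ)).indicator (fun v =>
          Complex.exp (((2 * Real.pi * (v * t) : ℝ) : ℂ) * Complex.I) * b v) v := fun v => by
      by_cases hv : v ∈ Set.Ioi (0 : ℝ)
      · simp [hB, hv]; left; ring_nf
      · simp [hB, hv]
    simp_rw [e]
    rw [integral_indicator measurableSet_Ioi]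
    conv_rhs => rw [← image_mul_sq_Ioi hc]
    rw [integral_image_eq_integral_abs_deriv_smul measurableSet_Ioi
      (fun r _ => hasDerivWithinAt_mul_sq _ _ _) (injOn_mul_sq_Ioi hc)]
    refine setIntegral_congr_fun measurableSet_Ioi fun r hr => ?_
    have hr' : 0 < r := hr
    rw [hbv r hr, abs_of_pos (by positivity), Complex.real_smul,
      show 2 * Real.pi * (12 * Real.pi * r ^ 2 * t) = 24 * Real.pi ^ 2 * t * r ^ 2 by ring]
    have : ((Real.pi : ℝ) : ℂ) ≠ 0 := by exact_mod_cast hpi.ne'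
    push_cast
    field_simp
    ring
  set M' := M ^ 3 * Real.exp (-(1 / 3) * s ^ 2) * (2 * Real.pi) with hM'
  have hle : ∀ σ ∈ Set.Ioi (0 : ℝ), ‖b σ‖
      ≤ (24 * Real.pi)⁻¹ * M' * Real.exp (-(1 / (2 * Real.pi)) * σ) :=
    fun σ hσ => by
    have hσ' : 0 < σ := hσ
    simp only [hb]
    rw [norm_mul, norm_inv, Complex.norm_real, Real.norm_of_nonneg (by positivity), mul_assoc]
    have := norm_circleInt_le h s (√(σ / (12 * Real.pi)))
    rw [Real.sq_sqrt (by positivity), show -6 * (σ / (12 * Real.pi)) = -(1 / (2 * Real.pi)) * σ by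
      field_simp; norm_num] at this
    gcongr
  have hBi : Integrable B := by
    rw [hB, integrable_indicator_iff measurableSet_Ioi]
    refine Integrable.mono' ((integrableOn_exp_mul_Ioi (a := -(1 / (2 * Real.pi)))
      (by rw [neg_lt_zero]; positivity) 0).const_mul ((24 * Real.pi)⁻¹ * M'))
      hbc.aestronglyMeasurable ?_
    exact (ae_restrict_iff' measurableSet_Ioi).2 (Filter.Eventually.of_forall hle)
  have hB2 : MemLp B 2 volume := by
    rw [hB, memLp_indicator_iff_restrict measurableSet_Ioi,
      memLp_two_iff_integrable_sq_norm hbc.aestronglyMeasurable]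
    refine Integrable.mono' ((integrableOn_exp_mul_Ioi (a := -(1 / Real.pi))
      (by rw [neg_lt_zero]; positivity) 0).const_mul (((24 * Real.pi)⁻¹ * M') ^ 2))
      (hbc.norm.pow 2).aestronglyMeasurable ?_
    refine (ae_restrict_iff' measurableSet_Ioi).2 (Filter.Eventually.of_forall fun σ hσ => ?_)
    rw [Real.norm_of_nonneg (by positivity)]
    refine (pow_le_pow_left₀ (norm_nonneg _) (hle σ hσ) 2).trans (le_of_eq ?_)
    rw [mul_pow, ← Real.exp_nat_mul]
    congr 2
    push_cast; field_simp
  simp_rw [hF]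
  rw [lintegral_enorm_fourierInv_sq hBi hB2]
  have e2 : ∀ x, ‖B x‖ₑ ^ 2 = (Set.Ioi (0 : ℝ)).indicator (fun v => ‖b v‖ₑ ^ 2) x := fun x => by
    by_cases hx : x ∈ Set.Ioi (0 : ℝ) <;> simp [hB, hx]
  simp_rw [e2]
  rw [lintegral_indicator measurableSet_Ioi]
  conv_lhs => rw [← image_mul_sq_Ioi hc]
  rw [lintegral_image_eq_lintegral_abs_deriv_mul measurableSet_Ioi
      (fun r _ => hasDerivWithinAt_mul_sq _ _ _) (injOn_mul_sq_Ioi hc),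
    ← lintegral_const_mul' _ _ ENNReal.ofReal_ne_top]
  refine setLIntegral_congr_fun measurableSet_Ioi fun r hr => ?_
  have hr' : 0 < r := hr
  rw [hbv r hr, abs_of_pos (by positivity), enorm_sq_eq_ofReal, enorm_sq_eq_ofReal,
    ← ENNReal.ofReal_mul (by positivity), ← ENNReal.ofReal_mul (by positivity),
    ← ENNReal.ofReal_mul (by positivity), norm_mul, norm_inv, Complex.norm_real,
    Real.norm_of_nonneg (by positivity)]
  congr 1
  field_simp
  ring

/-- The sixth power of the space-time norm of the wave with Fourier transform `g`. -/
noncomputable def waveNormSix (g : ℝ → ℂ) : ℝ≥0∞ := ∫⁻ t, ∫⁻ x, ‖wave g t x‖ₑ ^ 6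

/-- The Hundertmark–Zharnitsky representation of the Strichartz functional. -/
theorem waveNormSix_add_rotDefect {g : ℝ → ℂ} (hg : Continuous g) {M : ℝ}
    (h : ∀ η, ‖g η‖ ≤ M * Real.exp (-η ^ 2)) :
    ENNReal.ofReal (48 * Real.pi * cylJac ^ 2) * waveNormSix g + rotDefect g
      = ENNReal.ofReal (4 * Real.pi * cylJac) * (∫⁻ x, ‖g x‖ₑ ^ 2) ^ 3 := by
  have hP := continuous_planeInt hg h
  have e : ENNReal.ofReal (48 * Real.pi * cylJac ^ 2) * waveNormSix g
      = 2 * ∫⁻ s : ℝ, ∫⁻ r in Set.Ioi (0 : ℝ), ENNReal.ofReal r * ‖circleInt g s r‖ₑ ^ 2 := by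
    simp_rw [← lintegral_planeInt_sq hg h]
    rw [lintegral_const_mul' _ _ ENNReal.ofReal_ne_top, lintegral_lintegral_swap
      (f := fun s t => ‖planeInt g t s‖ₑ ^ 2)
      (((hP.comp continuous_swap).measurable.enorm.pow_const 2).aemeasurable)]
    simp_rw [← lintegral_wave_pow_six hg h]
    rw [lintegral_const_mul' _ _ ENNReal.ofReal_ne_top, waveNormSix, ← mul_assoc, ← mul_assoc]
    congr 1
    rw [show (2 : ℝ≥0∞) = ENNReal.ofReal 2 by simp, ← ENNReal.ofReal_mul (by positivity),
      ← ENNReal.ofReal_mul (by positivity)]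
    congr 1; ring
  rw [e, add_comm, rotDefect_add hg, ← mul_assoc, ← ENNReal.ofReal_mul (by positivity)]

/-! ### Passage to all of `L²` by lower semicontinuity -/

theorem ennreal_liminf_add_liminf_le (x y : ℕ → ℝ≥0∞) :
    Filter.liminf x Filter.atTop + Filter.liminf y Filter.atTop
      ≤ Filter.liminf (fun n => x n + y n) Filter.atTop := by
  simp only [Filter.liminf_eq_iSup_iInf_of_nat]
  rw [ENNReal.iSup_add_iSup_of_monotone]
  · refine iSup_mono fun n => le_iInf₂ fun i hi => add_le_add ?_ ?_
    · exact iInf₂_le i hi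
    · exact iInf₂_le i hi
  all_goals
    intro m n hmn
    exact le_iInf₂ fun i hi => iInf₂_le i (hmn.trans hi)

theorem exists_gaussian_bound {g : ℝ → ℂ} (hg : Continuous g) (hs : HasCompactSupport g) :
    ∃ M : ℝ, ∀ η, ‖g η‖ ≤ M * Real.exp (-η ^ 2) := by
  obtain ⟨M, hM⟩ := (by fun_prop : Continuous fun η => (Real.exp (η ^ 2) : ℂ) * g η)
    |>.bounded_above_of_compact_support hs.mul_left
  refine ⟨M, fun η => ?_⟩
  have := hM η
  rw [norm_mul, Complex.norm_real, Real.norm_of_nonneg (by positivity)] at this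
  rw [Real.exp_neg, ← div_eq_mul_inv, le_div_iff₀ (by positivity)]
  linarith

theorem schrodingerEvolution_ae_eq_wave {g : ℝ → ℂ} (h2 : MemLp g 2 volume) (h1 : Integrable g)
    (t : ℝ) : schrodingerEvolution t (𝓕⁻ (h2.toLp g)) =ᵐ[volume] wave g t := by
  have hph : MemLp (fun η => schrodingerPhase t η * g η) 2 volume := by
    refine h2.of_le
      ((continuous_schrodingerPhase t).aestronglyMeasurable.mul h2.aestronglyMeasurable) ?_
    exact Filter.Eventually.of_forall fun η => by simp [norm_schrodingerPhase]
  have hpi : Integrable (fun η => schrodingerPhase t η * g η) := by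
    refine h1.mono
      ((continuous_schrodingerPhase t).aestronglyMeasurable.mul h1.aestronglyMeasurable) ?_
    exact Filter.Eventually.of_forall fun η => by simp [norm_schrodingerPhase]
  have e : (memLp_schrodingerPhase_mul t (𝓕 (𝓕⁻ (h2.toLp g)))).toLp _ = hph.toLp _ := by
    rw [MemLp.toLp_eq_toLp_iff, FourierTransform.fourier_fourierInv_eq]
    filter_upwards [h2.coeFn_toLp] with η hη
    rw [hη]
  rw [schrodingerEvolution, e]
  exact fourierInv_toLp_ae_eq hpi hph

/-- The evolution is unitary, so one summability condition on the Fourier side gives almost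
everywhere convergence in `x` at every time. -/
theorem lintegral_schrodingerEvolution_sub (t : ℝ) (f₁ f₂ : Lp ℂ 2 (volume : Measure ℝ)) :
    ∫⁻ x, ‖schrodingerEvolution t f₁ x - schrodingerEvolution t f₂ x‖ₑ ^ 2
      = ∫⁻ η, ‖(𝓕 f₁ : Lp ℂ 2 (volume : Measure ℝ)) η
        - (𝓕 f₂ : Lp ℂ 2 (volume : Measure ℝ)) η‖ₑ ^ 2 := by
  have h1 : ∫⁻ x, ‖schrodingerEvolution t f₁ x - schrodingerEvolution t f₂ x‖ₑ ^ 2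
      = ‖schrodingerEvolution t f₁ - schrodingerEvolution t f₂‖ₑ ^ 2 := by
    rw [Lp_two_enorm_sq]
    refine lintegral_congr_ae ?_
    filter_upwards [Lp.coeFn_sub (schrodingerEvolution t f₁) (schrodingerEvolution t f₂)] with x hx
    rw [hx, Pi.sub_apply]
  have hsub : ∀ u v : Lp ℂ 2 (volume : Measure ℝ), 𝓕⁻ u - 𝓕⁻ v = 𝓕⁻ (u - v) := fun u v =>
    ((Lp.fourierTransformₗᵢ ℝ ℂ).symm.map_sub u v).symm
  rw [h1, schrodingerEvolution, schrodingerEvolution, hsub, Lp_two_enorm_fourierInv,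
    ← MemLp.toLp_sub, toLp_two_enorm_sq]
  refine lintegral_congr fun η => ?_
  rw [Pi.sub_apply, ← mul_sub, enorm_mul]
  congr 1
  rw [← ofReal_norm (schrodingerPhase t η), norm_schrodingerPhase]
  simp

/-- The sixth power of the space-time norm of `e^{itΔ} f`. -/
noncomputable def strichartzSix (f : Lp ℂ 2 (volume : Measure ℝ)) : ℝ≥0∞ :=
  ∫⁻ t : ℝ, ∫⁻ x : ℝ, ‖schrodingerEvolution t f x‖ₑ ^ 6

theorem strichartzSix_fourierInv_toLp {g : ℝ → ℂ} (h2 : MemLp g 2 volume) (h1 : Integrable g) :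
    strichartzSix (𝓕⁻ (h2.toLp g)) = waveNormSix g := by
  refine lintegral_congr fun t => lintegral_congr_ae ?_
  filter_upwards [schrodingerEvolution_ae_eq_wave h2 h1 t] with x hx
  rw [hx]

theorem continuous_wave {g : ℝ → ℂ} (hg : Continuous g) (h1 : Integrable g) :
    Continuous fun q : ℝ × ℝ => wave g q.1 q.2 := by
  simp only [wave, Real.fourierInv_eq', schrodingerPhase]
  refine continuous_of_dominated (bound := fun η => ‖g η‖)
    (fun q => Continuous.aestronglyMeasurable (by fun_prop))
    (fun q => Filter.Eventually.of_forall fun η => ?_) h1.norm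
    (Filter.Eventually.of_forall fun η => by fun_prop)
  rw [smul_eq_mul, norm_mul, norm_mul, Complex.norm_exp_ofReal_mul_I, one_mul, mul_comm Complex.I,
    Complex.norm_exp_ofReal_mul_I, one_mul]

/-- Lower semicontinuity of the rotation defect. -/
theorem rotDefect_le_liminf {g : ℕ → ℝ → ℂ} {g' : ℝ → ℂ} (hc : ∀ n, Continuous (g n))
    (h : ∀ᵐ x, Filter.Tendsto (fun n => g n x) Filter.atTop (nhds (g' x))) :
    rotDefect g' ≤ Filter.liminf (fun n => rotDefect (g n)) Filter.atTop := by
  have h3 : ∀ᵐ p, Filter.Tendsto (fun n => cylCube (g n) p) Filter.atTop (nhds (cylCube g' p)) :=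
    quasiMeasurePreserving_cylCoord.ae (tendsto_tensorCube_ae h)
  have hcc := fun n => continuous_cylCube (hc n)
  have hcont : ∀ n, Continuous fun q : ℝ × (ℝ × ℂ) =>
      ‖cylCube (g n) q.2 - cylCube (g n) (cylRot q.1 q.2)‖ₑ ^ 2 := fun n => by
    have := continuous_cylRot
    have := hcc n
    fun_prop
  -- Fatou is used twice, in `θ` and then in `p`.
  refine le_trans (lintegral_mono fun θ => ?_) (lintegral_liminf_le fun n =>
    (hcont n).measurable.lintegral_prod_right')
  refine le_trans (le_of_eq (lintegral_congr_ae ?_)) (lintegral_liminf_le fun n =>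
    ((hcont n).comp (by fun_prop : Continuous fun p : ℝ × ℂ => (θ, p))).measurable)
  filter_upwards [h3, (measurePreserving_cylRot θ).quasiMeasurePreserving.ae h3] with p h h'
  exact (((ENNReal.continuous_pow 2).tendsto _).comp (h.sub h').enorm).liminf_eq.symm

theorem lintegral_pow_six_le_liminf {u : ℕ → ℝ → ℂ} {v : ℝ → ℂ} (hu : ∀ n, Measurable (u n))
    (h : ∀ᵐ x, Filter.Tendsto (fun n => u n x) Filter.atTop (nhds (v x))) :
    ∫⁻ x, ‖v x‖ₑ ^ 6 ≤ Filter.liminf (fun n => ∫⁻ x, ‖u n x‖ₑ ^ 6) Filter.atTop := by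
  refine le_trans (le_of_eq (lintegral_congr_ae ?_))
    (lintegral_liminf_le fun n => (hu n).enorm.pow_const 6)
  filter_upwards [h] with x h
  exact (((ENNReal.continuous_pow 6).tendsto _).comp h.enorm).liminf_eq.symm

/-- Lower semicontinuity of the space-time norm. -/
theorem strichartzSix_le_liminf {f : ℕ → Lp ℂ 2 (volume : Measure ℝ)} {g : ℕ → ℝ → ℂ}
    {f' : Lp ℂ 2 (volume : Measure ℝ)} (hc : ∀ n, Continuous (g n)) (h1 : ∀ n, Integrable (g n))
    (h2 : ∀ n, MemLp (g n) 2 volume) (hf : ∀ n, f n = 𝓕⁻ ((h2 n).toLp (g n)))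
    (h : ∑' n, ∫⁻ η, ‖(𝓕 (f n) : Lp ℂ 2 (volume : Measure ℝ)) η
      - (𝓕 f' : Lp ℂ 2 (volume : Measure ℝ)) η‖ₑ ^ 2 ≠ ∞) :
    strichartzSix f' ≤ Filter.liminf (fun n => waveNormSix (g n)) Filter.atTop := by
  have hw := fun n => continuous_wave (hc n) (h1 n)
  have hw6 : ∀ n, Measurable fun q : ℝ × ℝ => ‖wave (g n) q.1 q.2‖ₑ ^ 6 := fun n =>
    (hw n).measurable.enorm.pow_const 6
  have key : ∀ t, ∫⁻ x, ‖schrodingerEvolution t f' x‖ₑ ^ 6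
      ≤ Filter.liminf (fun n => ∫⁻ x, ‖wave (g n) t x‖ₑ ^ 6) Filter.atTop := fun t => by
    have ht : ∀ᵐ x, Filter.Tendsto (fun n => schrodingerEvolution t (f n) x) Filter.atTop
        (nhds (schrodingerEvolution t f' x)) := by
      refine ae_tendsto_of_tsum_lintegral_ne_top
        (f := fun n x => schrodingerEvolution t (f n) x)
        (fun n => Lp.aestronglyMeasurable _) (Lp.aestronglyMeasurable _) ?_
      simp_rw [lintegral_schrodingerEvolution_sub]
      exact h
    have hall : ∀ᵐ x, ∀ n, schrodingerEvolution t (f n) x = wave (g n) t x :=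
      ae_all_iff.2 fun n => by rw [hf]; exact schrodingerEvolution_ae_eq_wave (h2 n) (h1 n) t
    refine lintegral_pow_six_le_liminf
      (fun n => ((hw n).comp (Continuous.prodMk_right t)).measurable) ?_
    filter_upwards [ht, hall] with x h h'
    simpa only [h'] using h
  calc strichartzSix f'
      ≤ ∫⁻ t, Filter.liminf (fun n => ∫⁻ x, ‖wave (g n) t x‖ₑ ^ 6) Filter.atTop :=
        lintegral_mono key
    _ ≤ _ := lintegral_liminf_le fun n => (hw6 n).lintegral_prod_right'

/-- The sharp Strichartz inequality with a remainder term. -/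
theorem strichartzSix_add_rotDefect_le (f : Lp ℂ 2 (volume : Measure ℝ)) :
    ENNReal.ofReal (48 * Real.pi * cylJac ^ 2) * strichartzSix f
      + rotDefect (𝓕 f : Lp ℂ 2 (volume : Measure ℝ))
      ≤ ENNReal.ofReal (4 * Real.pi * cylJac) * (‖f‖ₑ ^ 2) ^ 3 := by
  set G : Lp ℂ 2 (volume : Measure ℝ) := 𝓕 f with hG
  -- Compact support gives the Gaussian bound of the exact identity. The geometric rate makes the
  -- errors summable, so the whole sequence converges almost everywhere.
  have hex : ∀ n : ℕ, ∃ g : ℝ → ℂ, HasCompactSupport g ∧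
      eLpNorm ((G : ℝ → ℂ) - g) 2 volume ≤ (1 / 2) ^ n ∧
      Continuous g ∧ MemLp g 2 volume := fun n =>
    (Lp.memLp G).exists_hasCompactSupport_eLpNorm_sub_le (by norm_num) (by simp)
  choose g hgs hgd hgc hg2 using hex
  have hg1 : ∀ n, Integrable (g n) := fun n => (hgc n).integrable_of_hasCompactSupport (hgs n)
  choose M hM using fun n => exists_gaussian_bound (hgc n) (hgs n)
  have hfn : ∀ n, (𝓕 (𝓕⁻ ((hg2 n).toLp (g n))) : Lp ℂ 2 (volume : Measure ℝ)) = (hg2 n).toLp (g n) :=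
    fun n => FourierTransform.fourier_fourierInv_eq _
  have hnorm : ∀ n, ‖(hg2 n).toLp (g n) - G‖ₑ ≤ (1 / 2) ^ n := fun n => by
    rw [Lp.enorm_def, eLpNorm_congr_ae (Lp.coeFn_sub _ _), eLpNorm_sub_comm]
    refine le_trans (le_of_eq (eLpNorm_congr_ae ?_)) (hgd n)
    filter_upwards [(hg2 n).coeFn_toLp] with x hx
    simp [hx]
  have hint : ∀ n, ∫⁻ η, ‖(hg2 n).toLp (g n) η - G η‖ₑ ^ 2 ≤ (1 / 2) ^ n := fun n => by
    calc _ = ‖(hg2 n).toLp (g n) - G‖ₑ ^ 2 := by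
          rw [Lp_two_enorm_sq]
          refine lintegral_congr_ae ?_
          filter_upwards [Lp.coeFn_sub ((hg2 n).toLp (g n)) G] with x hx
          rw [hx, Pi.sub_apply]
      _ ≤ ((1 / 2) ^ n) ^ 2 := by gcongr; exact hnorm n
      _ ≤ (1 / 2) ^ n := by
          rw [sq]
          exact mul_le_of_le_one_left' (pow_le_one' (by simp) n)
  have hsum : ∑' n, ∫⁻ η, ‖(hg2 n).toLp (g n) η - G η‖ₑ ^ 2 ≠ ∞ := by
    refine ne_top_of_le_ne_top ?_ (ENNReal.tsum_le_tsum hint)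
    rw [ENNReal.tsum_geometric]
    simp
  have hae : ∀ᵐ x, Filter.Tendsto (fun n => g n x) Filter.atTop (nhds (G x)) := by
    have hall : ∀ᵐ x, ∀ n, (hg2 n).toLp (g n) x = g n x :=
      ae_all_iff.2 fun n => (hg2 n).coeFn_toLp
    filter_upwards [ae_tendsto_of_tsum_lintegral_ne_top (fun n => Lp.aestronglyMeasurable _)
      (Lp.aestronglyMeasurable _) hsum, hall] with x h h'
    simpa only [h'] using h
  have hN : Filter.Tendsto (fun n => ∫⁻ x, ‖g n x‖ₑ ^ 2) Filter.atTop (nhds (‖f‖ₑ ^ 2)) := by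
    simp_rw [← fun n => toLp_two_enorm_sq (hg2 n)]
    have : ‖f‖ₑ = ‖G‖ₑ := by rw [← ofReal_norm, ← ofReal_norm, hG, Lp.norm_fourier_eq]
    rw [this]
    refine ((ENNReal.continuous_pow 2).tendsto _).comp (Filter.Tendsto.enorm ?_)
    rw [tendsto_iff_enorm_sub_tendsto_zero]
    exact tendsto_of_tendsto_of_tendsto_of_le_of_le tendsto_const_nhds
      (ENNReal.tendsto_pow_atTop_nhds_zero_of_lt_one (by simp)) (fun _ => zero_le) hnorm
  have hlim : Filter.Tendsto (fun n => ENNReal.ofReal (4 * Real.pi * cylJac) *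
      (∫⁻ x, ‖g n x‖ₑ ^ 2) ^ 3) Filter.atTop
      (nhds (ENNReal.ofReal (4 * Real.pi * cylJac) * (‖f‖ₑ ^ 2) ^ 3)) :=
    ENNReal.Tendsto.const_mul (((ENNReal.continuous_pow 3).tendsto _).comp hN)
      (Or.inr ENNReal.ofReal_ne_top)
  have hS := strichartzSix_le_liminf (f' := f) hgc hg1 hg2 (fun n => rfl)
    (by simpa only [hfn] using hsum)
  have hD := rotDefect_le_liminf hgc hae
  have hpos : 0 < 48 * Real.pi * cylJac ^ 2 := by have := cylJac_pos; positivity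
  rw [← hlim.liminf_eq]
  refine (add_le_add (mul_le_mul_right hS _) hD).trans ?_
  rw [← ENNReal.liminf_const_mul_of_ne_zero_of_ne_top (by simpa using hpos) ENNReal.ofReal_ne_top]
  refine (ennreal_liminf_add_liminf_le _ _).trans (le_of_eq ?_)
  simp_rw [waveNormSix_add_rotDefect (hgc _) (hM _)]

/-! ### The sharp constant and the defect of an extremizer -/

theorem rotDefect_gaussian : rotDefect (fun η : ℝ => (Real.exp (-η ^ 2) : ℂ)) = 0 := by
  have h : ∀ p, cylCube (fun η : ℝ => (Real.exp (-η ^ 2) : ℂ)) p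
      = (Real.exp (-(p.1 ^ 2 / 3 + 6 * ‖p.2‖ ^ 2)) : ℂ) := fun p => by
    rw [← cylCoord_sq_sum, neg_add, neg_add, Real.exp_add, Real.exp_add]
    simp [cylCube, tensorCube]
  rw [rotDefect]
  simp_rw [h]
  simp [cylRot, Complex.norm_exp_ofReal_mul_I]

/-- The witness has Fourier transform `e^{-η²}`, whose tensor cube depends only on the distance from
the origin. It satisfies the Gaussian bound with `M = 1`, so the exact identity applies without
approximation. -/
theorem exists_strichartzSix_eq : ∃ f : Lp ℂ 2 (volume : Measure ℝ), f ≠ 0 ∧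
    ENNReal.ofReal (48 * Real.pi * cylJac ^ 2) * strichartzSix f
      = ENNReal.ofReal (4 * Real.pi * cylJac) * (‖f‖ₑ ^ 2) ^ 3 := by
  set g : ℝ → ℂ := fun η => (Real.exp (-η ^ 2) : ℂ) with hg
  have hc : Continuous g := by fun_prop
  have hb : ∀ η, ‖g η‖ ≤ 1 * Real.exp (-η ^ 2) := fun η => by
    rw [hg, Complex.norm_real, Real.norm_of_nonneg (by positivity), one_mul]
  have h1 : Integrable g := integrable_of_gaussian_bound (b := 1) (M := 1) hc.aestronglyMeasurable
    one_pos (fun η => by simpa using hb η)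
  have h2 : MemLp g 2 volume := memLp_two_of_gaussian_bound (b := 1) (M := 1) hc.aestronglyMeasurable
    one_pos (fun η => by simpa using hb η)
  have hn : ‖(𝓕⁻ (h2.toLp g) : Lp ℂ 2 (volume : Measure ℝ))‖ₑ ^ 2 = ∫⁻ x, ‖g x‖ₑ ^ 2 := by
    rw [Lp_two_enorm_fourierInv, toLp_two_enorm_sq]
  refine ⟨𝓕⁻ (h2.toLp g), fun h => ?_, ?_⟩
  · rw [h] at hn
    simp only [enorm_zero, ne_eq, OfNat.ofNat_ne_zero, not_false_eq_true, zero_pow] at hn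
    have := (lintegral_eq_zero_iff (hc.measurable.enorm.pow_const 2)).1 hn.symm
    obtain ⟨x, hx⟩ := this.exists
    simp [hg] at hx
  · rw [strichartzSix_fourierInv_toLp h2 h1, hn, ← waveNormSix_add_rotDefect hc hb,
      rotDefect_gaussian, add_zero]

/-- The rotation defect vanishes for Fourier transforms of extremizers. -/
theorem IsStrichartzExtremizer.rotDefect_eq_zero {f : Lp ℂ 2 (volume : Measure ℝ)}
    (hf : IsStrichartzExtremizer f) : rotDefect (𝓕 f : Lp ℂ 2 (volume : Measure ℝ)) = 0 := by
  obtain ⟨f₀, h0, hf₀⟩ := exists_strichartzSix_eq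
  have hpow : ∀ u : Lp ℂ 2 (volume : Measure ℝ), strichartzNorm u ^ 6 = strichartzSix u := fun u => by
    rw [strichartzNorm, ← ENNReal.rpow_natCast, ← ENNReal.rpow_mul]
    norm_num
    rfl
  have hn0 : ‖f₀‖ₑ ^ 6 ≠ 0 := by simpa using h0
  have hnt : ‖f₀‖ₑ ^ 6 ≠ ∞ := by simp
  have hC : strichartzSix f₀ ≤ strichartzConstant ^ 6 * ‖f₀‖ₑ ^ 6 := by
    have : strichartzNorm f₀ / ‖f₀‖ₑ ≤ strichartzConstant := le_iSup₂_of_le f₀ h0 le_rfl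
    rw [ENNReal.div_le_iff (by simpa using h0) (by simp)] at this
    rw [← hpow, ← mul_pow]
    gcongr
  -- Only this lower bound on the sharp constant is needed: inserted into the inequality with
  -- remainder for `f`, it leaves no room for the defect.
  have hge : ENNReal.ofReal (4 * Real.pi * cylJac)
      ≤ ENNReal.ofReal (48 * Real.pi * cylJac ^ 2) * strichartzConstant ^ 6 := by
    rw [← ENNReal.mul_le_mul_iff_left hn0 hnt, mul_assoc (ENNReal.ofReal _)]
    calc _ = ENNReal.ofReal (48 * Real.pi * cylJac ^ 2) * strichartzSix f₀ := by
          rw [hf₀, ← pow_mul]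
      _ ≤ _ := by exact mul_le_mul_right hC _
  have hle := strichartzSix_add_rotDefect_le f
  rw [← hpow, hf.2, mul_pow, ← mul_assoc, ← pow_mul] at hle
  have hfin : ENNReal.ofReal (4 * Real.pi * cylJac) * ‖f‖ₑ ^ 6 ≠ ∞ :=
    ENNReal.mul_ne_top ENNReal.ofReal_ne_top (by simp)
  have h2 : ENNReal.ofReal (4 * Real.pi * cylJac) * ‖f‖ₑ ^ 6
      + rotDefect (𝓕 f : Lp ℂ 2 (volume : Measure ℝ))
      ≤ ENNReal.ofReal (4 * Real.pi * cylJac) * ‖f‖ₑ ^ 6 + 0 := by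
    rw [add_zero]
    refine le_trans (add_le_add_left ?_ _) hle
    gcongr
  exact le_antisymm ((ENNReal.add_le_add_iff_left hfin).1 h2) zero_le

/-! ### Exponentials of quadratics and their Fourier transforms -/

/-- The exponential of a quadratic polynomial. -/
noncomputable def expQuad (A B C : ℂ) (x : ℝ) : ℂ := Complex.exp (A * (x : ℂ) ^ 2 + B * (x : ℂ) + C)

theorem continuous_expQuad (A B C : ℂ) : Continuous (expQuad A B C) := by
  unfold expQuad; fun_prop

theorem integrable_expQuad {A : ℂ} (hA : A.re < 0) (B C : ℂ) : Integrable (expQuad A B C) :=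
  integrable_cexp_quadratic' hA B C

theorem norm_expQuad_sq (A B C : ℂ) (x : ℝ) :
    ‖expQuad A B C x‖ ^ 2 = ‖expQuad (2 * A) (2 * B) (2 * C) x‖ := by
  rw [expQuad, expQuad, ← norm_pow, ← Complex.exp_nat_mul]
  congr 2
  push_cast; ring

theorem memLp_two_expQuad {A : ℂ} (hA : A.re < 0) (B C : ℂ) : MemLp (expQuad A B C) 2 volume := by
  rw [memLp_two_iff_integrable_sq_norm (continuous_expQuad A B C).aestronglyMeasurable]
  simp_rw [norm_expQuad_sq]
  exact (integrable_expQuad (by simp; linarith) _ _).norm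

theorem re_neg_of_memLp_two_expQuad {A B C : ℂ} (h : MemLp (expQuad A B C) 2 volume) :
    A.re < 0 := by
  by_contra! hA
  have h1 := (memLp_two_iff_integrable_sq_norm
    (continuous_expQuad A B C).aestronglyMeasurable).1 h
  -- Symmetrizing in `x` removes the linear term: `e^u + e^{-u} ≥ 2`. If `A.re ≥ 0`, a positive
  -- constant would then be integrable on `ℝ`.
  have h2 := h1.add h1.comp_neg
  have h3 : Integrable (fun _ : ℝ => 2 * Real.exp (2 * C.re)) volume := by
    refine h2.mono' aestronglyMeasurable_const (Filter.Eventually.of_forall fun x => ?_)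
    have e : ∀ y : ℝ, ‖expQuad A B C y‖ ^ 2
        = Real.exp (2 * C.re) * Real.exp (2 * A.re * y ^ 2) * Real.exp (2 * B.re * y) := fun y => by
      rw [expQuad, Complex.norm_exp, ← Real.exp_nat_mul, ← Real.exp_add, ← Real.exp_add]
      congr 1
      simp [← Complex.ofReal_pow]
      ring
    rw [Real.norm_of_nonneg (by positivity)]
    simp only [Pi.add_apply, e]
    have a1 : 1 ≤ Real.exp (2 * A.re * x ^ 2) := Real.one_le_exp (by positivity)
    have a2 := Real.add_one_le_exp (2 * B.re * x)
    have a3 := Real.add_one_le_exp (2 * B.re * -x)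
    have a4 : 2 ≤ Real.exp (2 * B.re * x) + Real.exp (2 * B.re * -x) := by linarith
    rw [neg_sq, ← mul_add]
    calc 2 * Real.exp (2 * C.re) = Real.exp (2 * C.re) * 1 * 2 := by ring
      _ ≤ _ := by gcongr
  rw [integrable_const_iff] at h3
  rcases h3 with h3 | h3
  · exact absurd h3 (by positivity)
  · simpa using h3.measure_univ_lt_top

theorem exists_fourier_expQuad {A : ℂ} (hA : A.re < 0) (B C : ℂ) :
    ∃ A' B' C' : ℂ, A'.re < 0 ∧ 𝓕 (expQuad A B C) = expQuad A' B' C' := by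
  have hpi := Real.pi_pos
  have hpi' : (Real.pi : ℂ) ≠ 0 := by exact_mod_cast hpi.ne'
  set b : ℂ := -A / Real.pi with hb
  set c : ℂ := B / (2 * Real.pi) with hc
  have hbre : 0 < b.re := by
    rw [hb, Complex.div_ofReal_re, Complex.neg_re]
    exact div_pos (by linarith) hpi
  have hb0 : b ≠ 0 := by intro h; rw [h] at hbre; simp at hbre
  have e1 : expQuad A B C = fun x => Complex.exp C *
      (fun x : ℝ => Complex.exp (-Real.pi * b * x ^ 2 + 2 * Real.pi * c * x)) x := by
    ext x
    simp only [expQuad, ← Complex.exp_add]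
    congr 1
    rw [hb, hc]
    field_simp
    ring
  have e2 : (1 / b ^ (1 / 2 : ℂ)) ≠ 0 := by
    rw [one_div]
    exact inv_ne_zero (by simp [Complex.cpow_eq_zero_iff, hb0])
  refine ⟨-Real.pi / b, -Real.pi / b * (2 * Complex.I * c),
    -Real.pi / b * (Complex.I * c) ^ 2 + C + Complex.log (1 / b ^ (1 / 2 : ℂ)), ?_, ?_⟩
  · rw [neg_div, Complex.neg_re, neg_lt_zero, div_eq_mul_inv, Complex.re_ofReal_mul,
      Complex.inv_re]
    have := Complex.normSq_pos.2 hb0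
    positivity
  · have h := fourier_gaussian_pi' hbre c
    ext t
    have h' := congrFun h t
    have e3 : 𝓕 (expQuad A B C) t = Complex.exp C *
        𝓕 (fun x : ℝ => Complex.exp (-Real.pi * b * x ^ 2 + 2 * Real.pi * c * x)) t := by
      rw [e1, Real.fourier_eq, Real.fourier_eq, ← integral_const_mul]
      refine integral_congr_ae (Filter.Eventually.of_forall fun v => ?_)
      simp only [Circle.smul_def, smul_eq_mul]
      ring
    rw [e3, h', expQuad, ← add_assoc, ← add_assoc, Complex.exp_add, Complex.exp_log e2,
      mul_left_comm, mul_comm, ← Complex.exp_add]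
    congr 2
    ring

theorem exists_fourierInv_expQuad {A : ℂ} (hA : A.re < 0) (B C : ℂ) :
    ∃ A' B' C' : ℂ, A'.re < 0 ∧ 𝓕⁻ (expQuad A B C) = expQuad A' B' C' := by
  obtain ⟨A', B', C', h, e⟩ := exists_fourier_expQuad hA B C
  refine ⟨A', -B', C', h, ?_⟩
  ext x
  rw [Real.fourierInv_eq_fourier_neg, e, expQuad, expQuad]
  congr 1
  push_cast
  ring

/-- A function whose inverse Fourier transform is a Gaussian is a Gaussian. -/
theorem exists_ae_eq_expQuad_of_fourierInv {E : ℝ → ℂ} (h1 : Integrable E) (h2 : MemLp E 2 volume)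
    {A B C : ℂ} (hA : A.re < 0) (h : 𝓕⁻ E = expQuad A B C) :
    ∃ A' B' C' : ℂ, E =ᵐ[volume] expQuad A' B' C' := by
  obtain ⟨A', B', C', hA', e⟩ := exists_fourier_expQuad hA B C
  refine ⟨A', B', C', ?_⟩
  have hi : 𝓕⁻ (expQuad A' B' C') = expQuad A B C := by
    rw [← e]
    exact (continuous_expQuad A B C).fourierInv_fourier_eq (integrable_expQuad hA B C)
      (by rw [e]; exact integrable_expQuad hA' B' C')
  have h1' := integrable_expQuad hA' B' C'
  have h2' := memLp_two_expQuad hA' B' C'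
  have hL : h2.toLp E = h2'.toLp _ := by
    apply (Lp.fourierTransformₗᵢ ℝ ℂ).symm.injective
    change 𝓕⁻ (h2.toLp E) = 𝓕⁻ (h2'.toLp _)
    refine Lp.ext ?_
    filter_upwards [fourierInv_toLp_ae_eq h1 h2, fourierInv_toLp_ae_eq h1' h2'] with x hx hx'
    rw [hx, hx', h, hi]
  exact (MemLp.toLp_eq_toLp_iff h2 h2').1 hL

/-! ### Rotation invariance forces a Gaussian -/

/-- The infinitesimal form of the invariance of `h ⊗ h ⊗ h` under rotations around the diagonal
forces `h` to be the exponential of a quadratic polynomial. -/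
theorem exists_eq_expQuad_of_cyclic {h : ℝ → ℂ} (hd : Differentiable ℝ h) {a : ℝ} (ha : h a ≠ 0)
    (hcyc : ∀ x y z : ℝ, ((z - y : ℝ) : ℂ) * deriv h x * h y * h z
      + ((x - z : ℝ) : ℂ) * h x * deriv h y * h z + ((y - x : ℝ) : ℂ) * h x * h y * deriv h z = 0) :
    ∃ A B C : ℂ, h = expQuad A B C := by
  obtain ⟨b, hba, hb⟩ : ∃ b, b ≠ a ∧ h b ≠ 0 := by
    have h1 : ∀ᶠ b in nhdsWithin a {a}ᶜ, h b ≠ 0 :=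
      (hd.continuous.continuousAt.eventually_ne ha).filter_mono nhdsWithin_le_nhds
    obtain ⟨b, h2, h3⟩ := (h1.and self_mem_nhdsWithin).exists
    exact ⟨b, h3, h2⟩
  have hab : (b : ℂ) - a ≠ 0 := sub_ne_zero.2 (by exact_mod_cast hba)
  -- The line `αy + β` interpolates the logarithmic derivative of `h` at `a` and `b`; the cyclic
  -- identity at `(y, a, b)` says that `h'/h` lies on it, in a form free of division by `h y`.
  set α : ℂ := (deriv h b / h b - deriv h a / h a) / (b - a) with hα
  set β : ℂ := (b * (deriv h a / h a) - a * (deriv h b / h b)) / (b - a) with hβ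
  have hode : ∀ y, deriv h y = (α * y + β) * h y := fun y => by
    have := hcyc y a b
    push_cast at this
    rw [hα, hβ]
    field_simp
    linear_combination this
  set K : ℝ → ℂ := fun y => h y * Complex.exp (-(α / 2 * (y : ℂ) ^ 2 + β * y)) with hK
  have hKd : ∀ y, HasDerivAt K 0 y := fun y => by
    have h1 : HasDerivAt (fun y : ℝ => (y : ℂ)) 1 y := Complex.ofRealCLM.hasDerivAt
    have h2 := (((h1.pow 2).const_mul (α / 2)).add (h1.const_mul β)).neg.cexp
    have h3 := (hd y).hasDerivAt.mul h2
    refine h3.congr_deriv ?_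
    rw [hode]
    simp
    ring
  have hKc : ∀ y, K y = K a := fun y =>
    is_const_of_deriv_eq_zero (fun y => (hKd y).differentiableAt) (fun y => (hKd y).deriv) y a
  have hKa : K a ≠ 0 := mul_ne_zero ha (Complex.exp_ne_zero _)
  refine ⟨α / 2, β, Complex.log (K a), ?_⟩
  ext y
  rw [expQuad, Complex.exp_add, Complex.exp_log hKa, ← hKc y, hK]
  simp only
  rw [mul_left_comm, ← Complex.exp_add, add_neg_cancel, Complex.exp_zero, mul_one]

theorem measurable_cylCube {g : ℝ → ℂ} (hg : Measurable g) : Measurable (cylCube g) := by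
  have : Measurable (tensorCube g) := by unfold tensorCube; fun_prop
  exact this.comp continuous_cylCoord.measurable

theorem ae_cylRot_of_rotDefect_eq_zero {g : ℝ → ℂ} (hg : Measurable g) (h : rotDefect g = 0) :
    ∀ᵐ θ ∂volume.restrict (Set.Ioo (-Real.pi) Real.pi),
      ∀ᵐ p, cylCube g p = cylCube g (cylRot θ p) := by
  have hm := measurable_cylCube hg
  have hm2 : Measurable fun q : ℝ × (ℝ × ℂ) =>
      ‖cylCube g q.2 - cylCube g (cylRot q.1 q.2)‖ₑ ^ 2 :=
    ((hm.comp measurable_snd).sub (hm.comp continuous_cylRot.measurable)).enorm.pow_const 2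
  have h1 := (lintegral_eq_zero_iff hm2.lintegral_prod_right').1 h
  filter_upwards [h1] with θ hθ
  have h2 := (lintegral_eq_zero_iff (hm2.comp measurable_prodMk_left)).1 hθ
  filter_upwards [h2] with p hp
  simpa [sub_eq_zero] using hp

/-- The tensor cube of an inverse Fourier transform, in cylindrical coordinates. -/
theorem cylCube_fourierInv (E : ℝ → ℂ) (q : ℝ × ℂ) :
    (cylJac : ℂ) * cylCube (𝓕⁻ E) q = ∫ p : ℝ × ℂ, Complex.exp (((2 * Real.pi *
      (p.1 * q.1 / 3 + 6 * (p.2 * (starRingEnd ℂ) q.2).re) : ℝ) : ℂ) * Complex.I) * cylCube E p := by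
  set c : ℝ × ℝ × ℝ := cylCoord q with hc
  set e : ℝ → ℝ → ℂ := fun v w => Complex.exp (((2 * Real.pi * (v * w) : ℝ) : ℂ) * Complex.I) with he
  have hF : ∀ w, 𝓕⁻ E w = ∫ v, e v w * E v := fun w => by
    rw [Real.fourierInv_eq']
    refine integral_congr_ae (Filter.Eventually.of_forall fun v => ?_)
    simp only [he, smul_eq_mul]
    congr 4
    simp [mul_comm]
  have h1 : cylCube (𝓕⁻ E) q = ∫ y : ℝ × ℝ × ℝ,
      (e y.1 c.1 * E y.1) * ((e y.2.1 c.2.1 * E y.2.1) * (e y.2.2 c.2.2 * E y.2.2)) := by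
    rw [Measure.volume_eq_prod, integral_prod_mul (f := fun v => e v c.1 * E v)
      (g := fun y : ℝ × ℝ => (e y.1 c.2.1 * E y.1) * (e y.2 c.2.2 * E y.2)),
      Measure.volume_eq_prod, integral_prod_mul (f := fun v => e v c.2.1 * E v)
      (g := fun v => e v c.2.2 * E v), ← hF, ← hF, ← hF, cylCube, tensorCube, mul_assoc]
  rw [h1, ← integral_comp_cylCoord]
  refine integral_congr_ae (Filter.Eventually.of_forall fun p => ?_)
  simp only
  rw [← cylCoord_inner, ← hc, cylCube, tensorCube,
    show 2 * Real.pi * ((cylCoord p).1 * c.1 + (cylCoord p).2.1 * c.2.1 + (cylCoord p).2.2 * c.2.2)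
      = 2 * Real.pi * ((cylCoord p).1 * c.1) + 2 * Real.pi * ((cylCoord p).2.1 * c.2.1)
        + 2 * Real.pi * ((cylCoord p).2.2 * c.2.2) by ring, Complex.ofReal_add, Complex.ofReal_add,
    add_mul, add_mul, Complex.exp_add, Complex.exp_add]
  simp only [he]
  ring

theorem cylRot_inner (θ : ℝ) (p q : ℝ × ℂ) :
    ((cylRot θ p).2 * (starRingEnd ℂ) (cylRot θ q).2).re = (p.2 * (starRingEnd ℂ) q.2).re := by
  simp only [cylRot, map_mul]
  rw [mul_mul_mul_comm, Complex.mul_conj, Complex.normSq_eq_norm_sq, Complex.norm_exp_ofReal_mul_I]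
  simp

/-- The Fourier transform on `ℝ³` commutes with rotations, and an integral ignores null sets: almost
everywhere invariance becomes invariance at every point `q`. -/
theorem cylCube_fourierInv_cylRot {E : ℝ → ℂ} {θ : ℝ}
    (h : ∀ᵐ p, cylCube E p = cylCube E (cylRot θ p)) (q : ℝ × ℂ) :
    cylCube (𝓕⁻ E) (cylRot θ q) = cylCube (𝓕⁻ E) q := by
  have hκ : (cylJac : ℂ) ≠ 0 := by exact_mod_cast cylJac_pos.ne'
  refine mul_left_cancel₀ hκ ?_
  rw [cylCube_fourierInv, cylCube_fourierInv,
    ← (measurePreserving_cylRot θ).integral_comp (measurableEmbedding_cylRot θ)]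
  refine integral_congr_ae ?_
  filter_upwards [h] with p hp
  rw [cylRot_inner, ← hp]
  rfl

/-- Rotation invariance of a differentiable tensor cube, in infinitesimal form. -/
theorem cyclic_of_cylRot_invariant {h : ℝ → ℂ} (hd : Differentiable ℝ h)
    (hrot : ∀ q, ∀ θ ∈ Set.Ioo (-Real.pi) Real.pi, cylCube h (cylRot θ q) = cylCube h q)
    (x y z : ℝ) :
    ((z - y : ℝ) : ℂ) * deriv h x * h y * h z + ((x - z : ℝ) : ℂ) * h x * deriv h y * h z
      + ((y - x : ℝ) : ℂ) * h x * h y * deriv h z = 0 := by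
  set q := cylCoord.symm (x, y, z) with hq
  have hqc : cylCoord q = (x, y, z) := cylCoord.apply_symm_apply _
  have hx : q.1 / 3 + 2 * q.2.re = x := congrArg (fun u => u.1) hqc
  have hy : q.1 / 3 - q.2.re - √3 * q.2.im = y := congrArg (fun u => u.2.1) hqc
  have hz : q.1 / 3 - q.2.re + √3 * q.2.im = z := congrArg (fun u => u.2.2) hqc
  have hre : HasDerivAt (fun θ : ℝ => (cylRot θ q).2.re) (-q.2.im) 0 := by
    have e : (fun θ : ℝ => (cylRot θ q).2.re)
        = fun θ => Real.cos θ * q.2.re - Real.sin θ * q.2.im := by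
      ext θ; simp [cylRot, Complex.exp_re, Complex.exp_im]
    rw [e]
    refine (((Real.hasDerivAt_cos 0).mul_const q.2.re).sub
      ((Real.hasDerivAt_sin 0).mul_const q.2.im)).congr_deriv ?_
    simp
  have him : HasDerivAt (fun θ : ℝ => (cylRot θ q).2.im) q.2.re 0 := by
    have e : (fun θ : ℝ => (cylRot θ q).2.im)
        = fun θ => Real.cos θ * q.2.im + Real.sin θ * q.2.re := by
      ext θ; simp [cylRot, Complex.exp_re, Complex.exp_im]
    rw [e]
    refine (((Real.hasDerivAt_cos 0).mul_const q.2.im).add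
      ((Real.hasDerivAt_sin 0).mul_const q.2.re)).congr_deriv ?_
    simp
  have h0 : cylRot 0 q = q := by simp [cylRot]
  have d1 : HasDerivAt (fun θ : ℝ => (cylCoord (cylRot θ q)).1) (2 * -q.2.im) 0 :=
    (hre.const_mul 2).const_add (q.1 / 3)
  have d2 : HasDerivAt (fun θ : ℝ => (cylCoord (cylRot θ q)).2.1) (- -q.2.im - √3 * q.2.re) 0 :=
    (hre.const_sub (q.1 / 3)).sub (him.const_mul √3)
  have d3 : HasDerivAt (fun θ : ℝ => (cylCoord (cylRot θ q)).2.2) (- -q.2.im + √3 * q.2.re) 0 :=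
    (hre.const_sub (q.1 / 3)).add (him.const_mul √3)
  have hh : ∀ {u : ℝ → ℝ} {u' w : ℝ}, u 0 = w → HasDerivAt u u' 0 →
      HasDerivAt (fun θ => h (u θ)) ((u' : ℂ) * deriv h w) 0 := fun hu hu' => by
    subst hu
    have := (hd _).hasDerivAt.scomp 0 hu'
    rwa [Complex.real_smul] at this
  have D := ((hh (by rw [h0, hqc]) d1).mul (hh (w := y) (by rw [h0, hqc]) d2)).mul
    (hh (w := z) (by rw [h0, hqc]) d3)
  have hconst : (fun θ : ℝ => cylCube h (cylRot θ q)) =ᶠ[nhds 0] fun _ => cylCube h q := by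
    filter_upwards [Ioo_mem_nhds (neg_lt_zero.2 Real.pi_pos) Real.pi_pos] with θ hθ
    exact hrot q θ hθ
  have D0 := (hasDerivAt_const (0 : ℝ) (cylCube h q)).congr_of_eventuallyEq hconst
  have key := D.unique D0
  have hs : √3 * √3 = 3 := Real.mul_self_sqrt (by norm_num)
  -- The rotation field is the cross product with the diagonal direction: the velocities of the
  -- three coordinates are the differences `z - y`, `x - z`, `y - x` up to the common factor `-√3`.
  have e1 : z - y = -√3 * (2 * -q.2.im) := by rw [← hy, ← hz]; ring
  have e2 : x - z = -√3 * (- -q.2.im - √3 * q.2.re) := by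
    rw [← hx, ← hz]; linear_combination (-q.2.re) * hs
  have e3 : y - x = -√3 * (- -q.2.im + √3 * q.2.re) := by
    rw [← hx, ← hy]; linear_combination q.2.re * hs
  simp only [h0, hqc, Pi.mul_apply] at key
  rw [e1, e2, e3]
  push_cast at key ⊢
  linear_combination -(√3 : ℂ) * key

/-- A function in `L²` whose tensor cube is invariant under rotations around the diagonal is
a Gaussian. -/
theorem exists_ae_eq_expQuad_of_rotDefect {g : ℝ → ℂ} (hg : Measurable g) (h2 : MemLp g 2 volume)
    (hne : ¬ g =ᵐ[volume] 0) (h : rotDefect g = 0) :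
    ∃ A B C : ℂ, g =ᵐ[volume] expQuad A B C := by
  -- The factor `e^{-η²}` makes `E` and `η E` integrable, so `𝓕⁻ E` is differentiable; its tensor
  -- cube is rotation invariant, so the symmetry survives.
  set E : ℝ → ℂ := fun η => expQuad (-1) 0 0 η * g η with hE
  have hgauss : ∀ η, ‖expQuad (-1) 0 0 η‖ ≤ 1 := fun η => by
    rw [expQuad, Complex.norm_exp, Real.exp_le_one_iff]
    simp [← Complex.ofReal_pow]
    positivity
  have hEm : Measurable E := (continuous_expQuad _ _ _).measurable.mul hg
  have hE1 : Integrable E := (memLp_two_expQuad (by simp) 0 0).integrable_mul h2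
  have hE2 : MemLp E 2 volume := h2.of_le hEm.aestronglyMeasurable
    (Filter.Eventually.of_forall fun η => by
      rw [hE, norm_mul]; exact mul_le_of_le_one_left (norm_nonneg _) (hgauss η))
  have hEx : Integrable (fun η : ℝ => η • E η) := by
    have : MemLp (fun η : ℝ => (η : ℂ) * expQuad (-1) 0 0 η) 2 volume := by
      refine memLp_two_of_gaussian_bound (b := 1 / 2) (M := 1)
        (Continuous.aestronglyMeasurable ?_) (by norm_num) fun η => ?_
      · have := continuous_expQuad (-1) 0 0
        fun_prop
      · rw [norm_mul, Complex.norm_real, Real.norm_eq_abs, expQuad, Complex.norm_exp, one_mul]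
        have e1 : ((-1 : ℂ) * (η : ℂ) ^ 2 + 0 * η + 0).re = -η ^ 2 := by
          simp [← Complex.ofReal_pow]
        have e2 : |η| ≤ Real.exp (1 / 2 * η ^ 2) := by
          have := Real.add_one_le_exp (1 / 2 * η ^ 2)
          nlinarith [sq_nonneg (|η| - 1), sq_abs η]
        rw [e1]
        calc |η| * Real.exp (-η ^ 2) ≤ Real.exp (1 / 2 * η ^ 2) * Real.exp (-η ^ 2) := by gcongr
          _ = _ := by rw [← Real.exp_add]; congr 1; ring
    refine (this.integrable_mul h2).congr (Filter.Eventually.of_forall fun η => ?_)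
    simp [hE, mul_assoc]
  have hcube : ∀ p, cylCube E p
      = Complex.exp (-((p.1 ^ 2 / 3 + 6 * ‖p.2‖ ^ 2 : ℝ) : ℂ)) * cylCube g p := fun p => by
    have e : ∀ η : ℝ, expQuad (-1) 0 0 η = Complex.exp (-(η : ℂ) ^ 2) := fun η => by
      simp [expQuad]
    rw [← cylCoord_sq_sum, show ∀ a b c : ℝ, -((a + b + c : ℝ) : ℂ) = -(a : ℂ) + -(b : ℂ) + -(c : ℂ)
      from fun a b c => by push_cast; ring, Complex.exp_add, Complex.exp_add]
    simp only [cylCube, tensorCube, hE, e]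
    push_cast
    ring
  have hd : Differentiable ℝ (𝓕⁻ E) := by
    rw [show 𝓕⁻ E = fun x => 𝓕 E (-x) from funext fun x => Real.fourierInv_eq_fourier_neg E x]
    have : Differentiable ℝ (𝓕 E) := fun w => (Real.hasDerivAt_fourier hE1 hEx w).differentiableAt
    exact this.comp differentiable_neg
  have hrot : ∀ q, ∀ θ ∈ Set.Ioo (-Real.pi) Real.pi,
      cylCube (𝓕⁻ E) (cylRot θ q) = cylCube (𝓕⁻ E) q := fun q => by
    have hc := continuous_cylCube hd.continuous
    have hcr := continuous_cylRot
    -- Zero defect gives invariance for almost every angle; continuity of `𝓕⁻ E` extends it to all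
    -- angles in the interval.
    refine Measure.eqOn_open_of_ae_eq (μ := volume)
      (f := fun θ => cylCube (𝓕⁻ E) (cylRot θ q)) (g := fun _ => cylCube (𝓕⁻ E) q) ?_ isOpen_Ioo
      (Continuous.continuousOn ?_) continuousOn_const
    · filter_upwards [ae_cylRot_of_rotDefect_eq_zero hg h] with θ hθ
      refine cylCube_fourierInv_cylRot ?_ q
      filter_upwards [hθ] with p hp
      rw [hcube, hcube, ← hp]
      simp [cylRot, Complex.norm_exp_ofReal_mul_I]
    · exact hc.comp (hcr.comp (by fun_prop : Continuous fun θ : ℝ => (θ, q)))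
  obtain ⟨a, ha⟩ : ∃ a, 𝓕⁻ E a ≠ 0 := by
    by_contra! h0
    have hpl := lintegral_enorm_fourierInv_sq hE1 hE2
    simp only [h0, enorm_zero, ne_eq, OfNat.ofNat_ne_zero, not_false_eq_true, zero_pow,
      lintegral_zero] at hpl
    have := (lintegral_eq_zero_iff (hEm.enorm.pow_const 2)).1 hpl.symm
    refine hne ?_
    filter_upwards [this] with η hη
    simpa [hE, expQuad, Complex.exp_ne_zero] using hη
  obtain ⟨A, B, C, hABC⟩ := exists_eq_expQuad_of_cyclic hd ha (cyclic_of_cylRot_invariant hd hrot)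
  have hm : MemLp (expQuad A B C) 2 volume := by
    rw [← hABC]
    exact (memLp_congr_ae (fourierInv_toLp_ae_eq hE1 hE2)).1 (Lp.memLp _)
  obtain ⟨A', B', C', e⟩ := exists_ae_eq_expQuad_of_fourierInv hE1 hE2
    (re_neg_of_memLp_two_expQuad hm) hABC
  -- Dividing by `e^{-η²}` adds 1 to the quadratic coefficient. The sign of its real part is not
  -- controlled here; square integrability of `g` settles it afterwards.
  refine ⟨A' + 1, B', C', ?_⟩
  filter_upwards [e] with η hη
  have h1 : g η = Complex.exp ((η : ℂ) ^ 2) * E η := by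
    simp [hE, expQuad, ← mul_assoc, ← Complex.exp_add]
  rw [h1, hη, expQuad, expQuad, ← Complex.exp_add]
  congr 1
  ring

/-- Every extremizer of the one-dimensional Strichartz inequality is a Gaussian. -/
theorem theorem2 (f : Lp ℂ 2 (volume : Measure ℝ)) (hf : IsStrichartzExtremizer f) :
    ∃ A B C : ℂ, A.re < 0 ∧
      ∀ᵐ x : ℝ ∂volume, f x = Complex.exp (A * (x : ℂ) ^ 2 + B * (x : ℂ) + C) := by
  set G : Lp ℂ 2 (volume : Measure ℝ) := 𝓕 f with hG
  have hGf : 𝓕⁻ G = f := FourierTransform.fourierInv_fourier_eq f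
  have hne : ¬ (G : ℝ → ℂ) =ᵐ[volume] 0 := fun h => hf.1 <| by
    have h0 : G = 0 := (Lp.eq_zero_iff_ae_eq_zero).2 h
    rw [← hGf, h0]
    exact (Lp.fourierTransformₗᵢ ℝ ℂ).symm.map_zero
  obtain ⟨A, B, C, e⟩ := exists_ae_eq_expQuad_of_rotDefect (Lp.stronglyMeasurable G).measurable
    (Lp.memLp G) hne hf.rotDefect_eq_zero
  have hm : MemLp (expQuad A B C) 2 volume := (memLp_congr_ae e).1 (Lp.memLp G)
  have hA := re_neg_of_memLp_two_expQuad hm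
  have hGm : G = hm.toLp _ := Lp.ext (e.trans hm.coeFn_toLp.symm)
  obtain ⟨A', B', C', hA', e'⟩ := exists_fourierInv_expQuad hA B C
  refine ⟨A', B', C', hA', ?_⟩
  have h1 := fourierInv_toLp_ae_eq (integrable_expQuad hA B C) hm
  rw [← hGm, hGf, e'] at h1
  exact h1
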